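/- Let $U,V:\mathbb R\to\mathbb R$, let $\lambda>0$, $K_V>0$ and $\sigma,K_g\in\mathbb R$, and assume: (1) $U,V\in C^7(\mathbb R)$, the functions $\nabla U=U'$ and $\nabla V=V'$ are globally Lipschitz, and their derivatives of orders $1,\dots,6$ are bounded; (2) $(U'(x)-U'(y))(x-y)\ge\lambda|x-y|^2$ for all $x,y\in\mathbb R$; $V$ is even, $(V'(x)-V'(y))(x-y)\ge0$ for all $x,y\in\mathbb R$, and $|V''|_\infty\le K_V$; and $\lambda\ge 7K_V$. For $N,n\in\mathbb N$ let $\Pi_n^N=\{1,\dots,N\}^n$, for $\gamma=(\gamma_1,\dots,\gamma_n)\in\Pi_n^N$ let $\hat{\mathcal O}(\gamma)$ be the number of distinct indices among $\gamma_1,\dots,\gamma_n$, and write $\partial^n_\gamma=\partial^n_{x_{\gamma_1},\dots,x_{\gamma_n}}$. Let $g:\mathbb R^N\to\mathbb R$ be a $C^6$ function that is Lipschitz together with its derivatives up to order $6$ and satisfies $$|\partial^n_\gamma g|_\infty\le K_g\,N^{-\hat{\mathcal O}(\gamma)}\qquad(1\le n\le 6,\ \gamma\in\Pi_n^N).$$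 Let $\boldsymbol W=(W^1,\dots,W^N)$ be a standard $N$-dimensional Brownian motion with respect to a filtration $(\mathcal F_t)_{t\ge0}$ on a probability space, and for $t\ge0$ and deterministic $\boldsymbol x\in\mathbb R^N$ let $(\boldsymbol X^{t,\boldsymbol x,N}_s)_{s\ge t}$ be the solution of $$\boldsymbol X^{t,\boldsymbol x,N}_s=\boldsymbol x+\int_t^s B(\boldsymbol X^{t,\boldsymbol x,N}_r)\,\mathrm dr+\sigma(\boldsymbol W_s-\boldsymbol W_t),\qquad B_i(\boldsymbol x)=-\nabla U(x_i)-\frac1N\sum_{j=1}^N\nabla V(x_i-x_j).$$ For $0\le t\le T$ let $u(t,\boldsymbol x)=\mathbb E[g(\boldsymbol X_T^{t,\boldsymbol x,N})]$, the (Feynman--Kac) solution of the Kolmogorov backward equation $\partial_tu+\sum_{i=1}^N\big(B_i\partial_{x_i}u+\tfrac12\sigma^2\partial^2_{x_i,x_i}u\big)=0$ on $[0,T)$, $u(T,\cdot)=g$. Then there exist constants $K>0$ and $\lambda_0\in(0,\lambda)$, depending only on $U,V,\lambda,K_V,\sigma,K_g$ (in particular independent of $t,T,N$), such that for all $N\in\mathbb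 N$, all $g$ as above and all $0\le t\le T$, the function $u(t,\cdot)$ is of class $C^6$, and for all $\mathcal F_t$-measurable, square-integrable and identically distributed random variables $\xi_1,\dots,\xi_N$, with $\boldsymbol\xi=(\xi_1,\dots,\xi_N)$, all $1\le n\le 6$ and all $\gamma\in\Pi_n^N$, $$\mathbb E\big[|\partial^n_\gamma u(t,\boldsymbol\xi)|^2\big]\le K e^{-\lambda_0(T-t)}N^{-2\hat{\mathcal O}(\gamma)},\qquad \mathbb E\big[|\partial^n_\gamma u(t,\boldsymbol\xi)|^4\big]\le K e^{-\lambda_0(T-t)}N^{-4\hat{\mathcal O}(\gamma)},$$ where the expectations are those of integrable random variables. -/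

import Mathlib

open MeasureTheory ProbabilityTheory
open scoped NNReal

noncomputable section

/-- The standing assumptions on the confining potential `U` and the interaction potential `V`
(`∇U = deriv U`, `∇²V = deriv (deriv V)`; `lam` is the convexity parameter of `U` and `KV` the bound
on `∇²V`). -/
structure PotentialAssumptions (U V : ℝ → ℝ) (lam KV : ℝ) : Prop where
  contDiff_U : ContDiff ℝ 7 U
  contDiff_V : ContDiff ℝ 7 V
  lipschitz_U : ∃ L : ℝ≥0, LipschitzWith L (deriv U)
  lipschitz_V : ∃ L : ℝ≥0, LipschitzWith L (deriv V)
  lam_pos : 0 < lam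
  convex_U : ∀ x y : ℝ, lam * |x - y| ^ 2 ≤ (deriv U x - deriv U y) * (x - y)
  even_V : ∀ x : ℝ, V (-x) = V x
  convex_V : ∀ x y : ℝ, 0 ≤ (deriv V x - deriv V y) * (x - y)
  KV_pos : 0 < KV
  hessian_V : ∀ x : ℝ, |deriv (deriv V) x| ≤ KV
  /-- the derivatives of `∇U` (of orders `1, …, 6`) are bounded -/
  bounded_U : ∀ k : ℕ, 1 ≤ k → k ≤ 6 → ∃ C : ℝ, ∀ x : ℝ, |iteratedDeriv k (deriv U) x| ≤ C
  /-- the derivatives of `∇V` (of orders `1, …, 6`) are bounded -/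
  bounded_V : ∀ k : ℕ, 1 ≤ k → k ≤ 6 → ∃ C : ℝ, ∀ x : ℝ, |iteratedDeriv k (deriv V) x| ≤ C
  lam_large : 7 * KV ≤ lam

/-- The number of distinct indices (the number of `j` with a non-zero frequency) in the multi-index
`γ = (γ₁, …, γₙ) ∈ {1, …, N}ⁿ`. -/
def numDistinct {n N : ℕ} (γ : Fin n → Fin N) : ℕ :=
  (Finset.univ.filter fun j : Fin N => (Finset.univ.filter fun k : Fin n => γ k = j).card ≠ 0).card

/-- The mixed partial derivative `∂ⁿ f / ∂x_{γ₁} … ∂x_{γₙ}` at `x` (used for functions of class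
`Cⁿ`). -/
def mixedPartial {n N : ℕ} (γ : Fin n → Fin N) (f : (Fin N → ℝ) → ℝ) (x : Fin N → ℝ) : ℝ :=
  iteratedFDeriv ℝ n f x fun k => Pi.single (γ k) 1

/-- The assumptions on the test function `g : ℝᴺ → ℝ`, where `Kg` is the constant in the bounds on
its derivatives. The Lipschitz constants may be arbitrary (and depend on `N`). -/
structure TestFunctionAssumptions {N : ℕ} (g : (Fin N → ℝ) → ℝ) (Kg : ℝ) : Prop where
  contDiff : ContDiff ℝ 6 g
  bound : ∀ n : ℕ, 1 ≤ n → n ≤ 6 → ∀ (γ : Fin n → Fin N) (x : Fin N → ℝ),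
    |mixedPartial γ g x| ≤ Kg / (N : ℝ) ^ numDistinct γ
  lipschitz : ∀ n : ℕ, n ≤ 6 → ∃ L : ℝ≥0, LipschitzWith L (iteratedFDeriv ℝ n g)

/-- The drift `B_i(x) = -∇U(x_i) - (1/N) ∑_j ∇V(x_i - x_j)` of the interacting particle system. -/
def drift (U V : ℝ → ℝ) {N : ℕ} (x : Fin N → ℝ) (i : Fin N) : ℝ :=
  -deriv U (x i) - (1 / (N : ℝ)) * ∑ j : Fin N, deriv V (x i - x j)

/-- `W` is a standard `N`-dimensional Brownian motion relative to the filtration `ℱ`: it is adapted,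
its components are independent one-dimensional standard Brownian motions, and its increments after
time `s` are independent of `ℱ s`. -/
structure IsBrownianMotion {Ω : Type*} [mΩ : MeasurableSpace Ω] (P : Measure Ω)
    (ℱ : Filtration ℝ≥0 mΩ) {N : ℕ} (W : ℝ≥0 → Ω → Fin N → ℝ) : Prop where
  adapted : ∀ t, Measurable[ℱ t] (W t)
  brownian : ∀ i : Fin N, IsBrownianReal (fun t ω => W t ω i) P
  iIndep : iIndepFun (fun (i : Fin N) ω (t : ℝ≥0) => W t ω i) P
  indep : ∀ s t, s ≤ t →
    Indep (MeasurableSpace.comap (fun ω => W t ω - W s ω) inferInstance) (ℱ s) P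

/-- `Y = (Y_s)_{s ≥ t}` is a (strong) solution of the particle system started at time `t` from the
deterministic point `x`:
`Y_s = x + ∫_t^s B(Y_r) dr + σ (W_s - W_t)` for `s ≥ t`. -/
structure IsParticleSolution {Ω : Type*} [mΩ : MeasurableSpace Ω] (P : Measure Ω)
    (ℱ : Filtration ℝ≥0 mΩ) (U V : ℝ → ℝ) (σ : ℝ) {N : ℕ} (W : ℝ≥0 → Ω → Fin N → ℝ)
    (t : ℝ≥0) (x : Fin N → ℝ) (Y : ℝ≥0 → Ω → Fin N → ℝ) : Prop where
  adapted : ∀ s, t ≤ s → Measurable[ℱ s] (Y s)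
  continuous : ∀ᵐ ω ∂P, ContinuousOn (fun s => Y s ω) (Set.Ici t)
  equation : ∀ᵐ ω ∂P, ∀ s, t ≤ s → ∀ i : Fin N,
    Y s ω i = x i + (∫ r in (t : ℝ)..(s : ℝ), drift U V (Y r.toNNReal ω) i)
      + σ * (W s ω i - W t ω i)

/-- The solution `u(t, x) = E[g(X_T^{t,x,N})]` of the Kolmogorov backward equation, where
`X t x = (X_s^{t,x,N})_{s ≥ t}` is the particle system started at time `t` from `x`. -/
def kolmogorovSolution {Ω : Type*} [MeasurableSpace Ω] (P : Measure Ω) {N : ℕ}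
    (g : (Fin N → ℝ) → ℝ) (X : ℝ≥0 → (Fin N → ℝ) → ℝ≥0 → Ω → Fin N → ℝ) (T t : ℝ≥0)
    (x : Fin N → ℝ) : ℝ :=
  ∫ ω, g (X t x T ω) ∂P

end

/-! The noise is additive, so for a fixed sample path the flow `x ↦ X^{t,x}` solves a deterministic
Volterra equation on `[t,T]`. All estimates are made on this flow, path by path and uniformly in the
path; probability enters only when the expectation defining `u` is differentiated under the integral
sign.

The quantity propagated is the separation weight `N^{-|S \ {i}|}`, with `S` the set of values of
`γ`: the derivative of the `i`-th particle in the directions `γ` is at most `C e^{-λ(s-t)/2}` times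
this weight (`exists_abs_mixedPartial_flow_le`). Differentiating the equation along `γ` gives, at
every order, the same linear system: damping `U'' ≥ λ`, nonnegative mean-field coupling `V''/N`, and
a forcing which by Faà di Bruno involves only derivatives of lower order. A weighted maximum
principle (`abs_le_of_cooperative_system`, `abs_le_sepWeight_of_meanField_system`) gives decay: of
the rate `λ`, one quarter pays for the variation of the weights under the coupling and one quarter
for the forcing, which leaves `λ/2`. Induction on the order is then closed by the combinatorics of
the weights, where each sum over a free particle is compensated by a factor `1/N`, except at the
boundedly many indices already present.

The chain rule for `g ∘ X_T` combines the weights of the flow with those of `g` into `N^{-|S|}`,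
again with `e^{-λ(T-t)/2}` (`exists_abs_mixedPartial_comp_flow_le`). Smoothness of the flow comes
from inverting a contraction perturbation of the identity in path space
(`exists_solution_operator`). Since the resulting bound on the derivatives of `u` is pointwise in
`x`, the second and fourth moments at a random point follow at once. -/

/-! ### Combinatorics of the separation weights -/

section SeparationWeights

/-- The weight `N ^ (-#(S \ R))`: a factor `1 / N` for every index of `S` outside `R`. -/
noncomputable def sepWeight {N : ℕ} (S R : Finset (Fin N)) : ℝ := ((N : ℝ)⁻¹) ^ (S \ R).card

variable {N : ℕ}

lemma inv_natCast_le_one (N : ℕ) : (N : ℝ)⁻¹ ≤ 1 := Nat.cast_inv_le_one N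

lemma natCast_mul_inv_le_one (N : ℕ) : (N : ℝ) * (N : ℝ)⁻¹ ≤ 1 := mul_inv_le_one

lemma sepWeight_nonneg (S R : Finset (Fin N)) : 0 ≤ sepWeight S R := by
  unfold sepWeight; positivity

lemma sepWeight_pos (S R : Finset (Fin N)) (i : Fin N) : 0 < sepWeight S R := by
  have : 0 < N := i.pos
  unfold sepWeight; positivity

lemma sepWeight_le_of_card_le {S R S' R' : Finset (Fin N)} (h : (S' \ R').card ≤ (S \ R).card) :
    sepWeight S R ≤ sepWeight S' R' :=
  pow_le_pow_of_le_one (by positivity) (inv_natCast_le_one N) h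

lemma sepWeight_mono_right {S R R' : Finset (Fin N)} (h : R ⊆ R') :
    sepWeight S R ≤ sepWeight S R' :=
  sepWeight_le_of_card_le (Finset.card_le_card (Finset.sdiff_subset_sdiff le_rfl h))

lemma numDistinct_eq_card_image {n : ℕ} (γ : Fin n → Fin N) :
    numDistinct γ = (Finset.univ.image γ).card := by
  unfold numDistinct
  congr 1
  ext j
  simp [Finset.filter_eq_empty_iff]

lemma sepWeight_empty_right {n : ℕ} (γ : Fin n → Fin N) :
    sepWeight (Finset.univ.image γ) ∅ = ((N : ℝ)⁻¹) ^ numDistinct γ := by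
  simp [sepWeight, numDistinct_eq_card_image]

/-- Every value of `γ` outside `R` is taken in some block, so the exponents on the left add up to at
least the exponent on the right. -/
lemma prod_sepWeight_le {n : ℕ} (γ : Fin n → Fin N) (c : OrderedFinpartition n)
    (R : Finset (Fin N)) :
    ∏ m, sepWeight (Finset.univ.image (γ ∘ c.emb m)) R ≤ sepWeight (Finset.univ.image γ) R := by
  unfold sepWeight
  rw [Finset.prod_pow_eq_pow_sum]
  refine pow_le_pow_of_le_one (by positivity) (inv_natCast_le_one N) ?_
  refine le_trans (Finset.card_le_card ?_) Finset.card_biUnion_le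
  intro j hj
  simp only [Finset.mem_sdiff, Finset.mem_image, Finset.mem_univ, true_and, Finset.mem_biUnion,
    Function.comp_apply] at hj ⊢
  obtain ⟨⟨k, rfl⟩, hjR⟩ := hj
  exact ⟨c.index k, ⟨c.invEmbedding k, by simp⟩, hjR⟩

/-- Only an index `j` in `S \ {i}` changes the weight, gaining a factor `N`. The prefactor absorbs
this gain, and there are at most `|S|` such indices; the other terms average to at most one weight.
-/
lemma sum_sepWeight_pair_le (S : Finset (Fin N)) (i : Fin N) :
    (N : ℝ)⁻¹ * ∑ j, sepWeight S {i, j} ≤ (1 + S.card) * sepWeight S {i} := by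
  have hq : (0 : ℝ) ≤ (N : ℝ)⁻¹ := by positivity
  have key : ∀ j : Fin N, (N : ℝ)⁻¹ * sepWeight S {i, j} ≤
      (N : ℝ)⁻¹ * sepWeight S {i} + if j ∈ S then sepWeight S {i} else 0 := by
    intro j
    by_cases hj : j ∈ S \ {i}
    · have hjS : j ∈ S := (Finset.mem_sdiff.1 hj).1
      rw [if_pos hjS]
      have h1 : (N : ℝ)⁻¹ * sepWeight S {i, j} = sepWeight S {i} := by
        unfold sepWeight
        rw [← pow_succ']
        congr 1
        have : S \ {i, j} = (S \ {i}).erase j := by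
          ext k; simp only [Finset.mem_sdiff, Finset.mem_insert, Finset.mem_singleton,
            Finset.mem_erase]; tauto
        rw [this, Finset.card_erase_add_one hj]
      rw [h1]
      have := mul_nonneg hq (sepWeight_nonneg S {i})
      linarith
    · have h1 : S \ {i, j} = S \ {i} := by
        ext k
        simp only [Finset.mem_sdiff, Finset.mem_insert, Finset.mem_singleton] at hj ⊢
        constructor
        · tauto
        · rintro ⟨h2, h3⟩
          refine ⟨h2, fun h4 => ?_⟩
          rcases h4 with h4 | h4
          · exact h3 h4
          · subst h4; exact hj ⟨h2, h3⟩
      have h2 : sepWeight S {i, j} = sepWeight S {i} := by unfold sepWeight; rw [h1]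
      rw [h2]
      have := sepWeight_nonneg S {i}
      split_ifs <;> linarith
  rw [Finset.mul_sum]
  calc _ ≤ ∑ j : Fin N, ((N : ℝ)⁻¹ * sepWeight S {i} + if j ∈ S then sepWeight S {i} else 0) :=
        Finset.sum_le_sum fun j _ => key j
    _ = (N * (N : ℝ)⁻¹) * sepWeight S {i} + S.card * sepWeight S {i} := by
        rw [Finset.sum_add_distrib, ← Finset.sum_filter]
        simp [mul_assoc]
    _ ≤ _ := by
        rw [add_mul]
        gcongr
        · exact sepWeight_nonneg _ _
        · exact natCast_mul_inv_le_one N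

/-- A fresh index outside `S ∪ I` costs `1/N`, so all of these together contribute at most one
weight; at most `|S| + |I|` indices come for free. -/
lemma sum_sepWeight_insert_le (S I : Finset (Fin N)) :
    ∑ j, sepWeight (insert j I) S ≤ (1 + S.card + I.card) * sepWeight I S := by
  have key : ∀ j : Fin N, sepWeight (insert j I) S ≤
      (N : ℝ)⁻¹ * sepWeight I S + if j ∈ S ∪ I then sepWeight I S else 0 := by
    intro j
    have hn := mul_nonneg (show (0 : ℝ) ≤ (N : ℝ)⁻¹ by positivity) (sepWeight_nonneg I S)
    by_cases hj : j ∈ S ∪ I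
    · rw [if_pos hj]
      have : sepWeight (insert j I) S ≤ sepWeight I S :=
        sepWeight_le_of_card_le (Finset.card_le_card
          (Finset.sdiff_subset_sdiff (Finset.subset_insert _ _) le_rfl))
      linarith
    · rw [if_neg hj, add_zero]
      simp only [Finset.mem_union, not_or] at hj
      unfold sepWeight
      rw [← pow_succ', Finset.insert_sdiff_of_notMem _ hj.1, Finset.card_insert_of_notMem]
      simp [hj.2]
  calc _ ≤ ∑ j : Fin N, ((N : ℝ)⁻¹ * sepWeight I S + if j ∈ S ∪ I then sepWeight I S else 0) :=
        Finset.sum_le_sum fun j _ => key j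
    _ = (N * (N : ℝ)⁻¹) * sepWeight I S + (S ∪ I).card * sepWeight I S := by
        rw [Finset.sum_add_distrib, ← Finset.sum_filter]
        simp only [Finset.sum_const, nsmul_eq_mul, Finset.card_univ, Fintype.card_fin,
          Finset.filter_mem_eq_inter, Finset.univ_inter]
        ring
    _ ≤ 1 * sepWeight I S + (S.card + I.card) * sepWeight I S := by
        have h1 : ((S ∪ I).card : ℝ) ≤ S.card + I.card := by
          exact_mod_cast Finset.card_union_le S I
        have := sepWeight_nonneg I S
        gcongr
        exact natCast_mul_inv_le_one N
    _ = _ := by ring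

lemma sum_sepWeight_image_le (S : Finset (Fin N)) {k : ℕ} (hS : S.card ≤ k) (m : ℕ) :
    ∑ r : Fin m → Fin N, sepWeight (Finset.univ.image r) S ≤ (1 + k + m : ℝ) ^ m := by
  suffices h : ∀ l ≤ m, ∑ r : Fin l → Fin N, sepWeight (Finset.univ.image r) S
      ≤ (1 + k + m : ℝ) ^ l from h m le_rfl
  intro l
  induction l with
  | zero => intro _; simp [sepWeight]
  | succ l ih =>
    intro hl
    have himg : ∀ p : Fin N × (Fin l → Fin N),
        Finset.univ.image (Fin.cons (α := fun _ => Fin N) p.1 p.2) =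
          insert p.1 (Finset.univ.image p.2) := by
      rintro ⟨j, r⟩
      ext a
      simp only [Finset.mem_image, Finset.mem_univ, true_and, Finset.mem_insert, Fin.exists_fin_succ,
        Fin.cons_zero, Fin.cons_succ]
      tauto
    rw [← (Fin.consEquiv (fun _ : Fin (l + 1) => Fin N)).sum_comp, Fintype.sum_prod_type,
      Finset.sum_comm]
    calc _ = ∑ r : Fin l → Fin N, ∑ j, sepWeight (insert j (Finset.univ.image r)) S :=
          Finset.sum_congr rfl fun r _ => Finset.sum_congr rfl fun j _ => by
            rw [← himg (j, r)]; rfl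
      _ ≤ ∑ r : Fin l → Fin N, (1 + k + m : ℝ) * sepWeight (Finset.univ.image r) S := by
          refine Finset.sum_le_sum fun r _ => (sum_sepWeight_insert_le _ _).trans ?_
          refine mul_le_mul_of_nonneg_right ?_ (sepWeight_nonneg _ _)
          have h1 : (Finset.univ.image r).card ≤ m :=
            Finset.card_image_le.trans (by simpa using by omega)
          have h2 : ((Finset.univ.image r).card : ℝ) ≤ m := by exact_mod_cast h1
          have h3 : (S.card : ℝ) ≤ k := by exact_mod_cast hS
          linarith
      _ ≤ (1 + k + m : ℝ) * (1 + k + m : ℝ) ^ l := by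
          rw [← Finset.mul_sum]
          exact mul_le_mul_of_nonneg_left (ih (by omega)) (by positivity)
      _ = _ := by ring

/-- With `S` and `R` the value sets of `γ` and `r`, this rests on `|R| + |S \ R| = |S ∪ R| = |S| +
|R \ S|`. The full weight of `γ` is thereby extracted, and the remaining factor is summable over `r`
by `sum_sepWeight_image_le`. -/
lemma sepWeight_mul_prod_le {n : ℕ} (γ : Fin n → Fin N) (c : OrderedFinpartition n)
    (r : Fin c.length → Fin N) :
    sepWeight (Finset.univ.image r) ∅ *
        ∏ m, sepWeight (Finset.univ.image (γ ∘ c.emb m)) {r m} ≤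
      sepWeight (Finset.univ.image γ) ∅ *
        sepWeight (Finset.univ.image r) (Finset.univ.image γ) := by
  calc _ ≤ sepWeight (Finset.univ.image r) ∅ *
        ∏ m, sepWeight (Finset.univ.image (γ ∘ c.emb m)) (Finset.univ.image r) := by
        refine mul_le_mul_of_nonneg_left ?_ (sepWeight_nonneg _ _)
        refine Finset.prod_le_prod (fun _ _ => sepWeight_nonneg _ _) fun m _ => ?_
        exact sepWeight_mono_right (by simp)
    _ ≤ sepWeight (Finset.univ.image r) ∅ *
        sepWeight (Finset.univ.image γ) (Finset.univ.image r) :=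
        mul_le_mul_of_nonneg_left (prod_sepWeight_le γ c _) (sepWeight_nonneg _ _)
    _ = _ := by
        unfold sepWeight
        rw [← pow_add, ← pow_add]
        congr 1
        simp only [Finset.sdiff_empty]
        have h1 := Finset.card_sdiff_add_card (Finset.univ.image γ) (Finset.univ.image r)
        have h2 := Finset.card_sdiff_add_card (Finset.univ.image r) (Finset.univ.image γ)
        rw [Finset.union_comm] at h2
        omega

end SeparationWeights

/-! ### Faà di Bruno's formula in coordinates -/

section MixedPartials

variable {N : ℕ}

lemma mixedPartial_comp {n : ℕ} (γ : Fin n → Fin N) {h : ℝ → ℝ} {f : (Fin N → ℝ) → ℝ}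
    (hh : ContDiff ℝ n h) (hf : ContDiff ℝ n f) (x : Fin N → ℝ) :
    mixedPartial γ (fun y => h (f y)) x = ∑ c : OrderedFinpartition n,
      iteratedDeriv c.length h (f x) * ∏ m, mixedPartial (γ ∘ c.emb m) f x := by
  unfold mixedPartial
  have := iteratedFDeriv_comp (g := h) (f := f) (x := x) hh.contDiffAt hf.contDiffAt
    (i := n) le_rfl
  change iteratedFDeriv ℝ n (h ∘ f) x _ = _
  rw [this]
  simp only [FormalMultilinearSeries.taylorComp, sum_apply,
    FormalMultilinearSeries.compAlongOrderedFinpartition_apply]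
  refine Finset.sum_congr rfl fun c _ => ?_
  simp only [ftaylorSeries]
  rw [iteratedFDeriv_apply_eq_iteratedDeriv_mul_prod, smul_eq_mul, mul_comm]
  rfl

/-- The derivative of `f` along each block is a vector; expanding it in the standard basis produces
one free index `r m` per block. -/
lemma mixedPartial_comp_pi {n : ℕ} (γ : Fin n → Fin N) {g : (Fin N → ℝ) → ℝ}
    {f : (Fin N → ℝ) → (Fin N → ℝ)}
    (hg : ContDiff ℝ n g) (hf : ContDiff ℝ n f) (x : Fin N → ℝ) :
    mixedPartial γ (fun y => g (f y)) x = ∑ c : OrderedFinpartition n,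
      ∑ r : Fin c.length → Fin N,
        (∏ m, mixedPartial (γ ∘ c.emb m) (fun y => f y (r m)) x) * mixedPartial r g (f x) := by
  unfold mixedPartial
  have := iteratedFDeriv_comp (g := g) (f := f) (x := x) hg.contDiffAt hf.contDiffAt
    (i := n) le_rfl
  change iteratedFDeriv ℝ n (g ∘ f) x _ = _
  rw [this]
  simp only [FormalMultilinearSeries.taylorComp, sum_apply,
    FormalMultilinearSeries.compAlongOrderedFinpartition_apply]
  refine Finset.sum_congr rfl fun c _ => ?_
  simp only [ftaylorSeries]
  have hvec : (c.applyOrderedFinpartition (fun m => iteratedFDeriv ℝ (c.partSize m) f x)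
      fun k => Pi.single (γ k) (1 : ℝ)) = fun m => ∑ i : Fin N,
        mixedPartial (γ ∘ c.emb m) (fun y => f y i) x • (Pi.single i (1 : ℝ) : Fin N → ℝ) := by
    funext m
    rw [OrderedFinpartition.applyOrderedFinpartition_apply]
    ext i
    have hc : c.partSize m ≤ n := c.partSize_le m
    have h2 := (ContinuousLinearMap.proj (R := ℝ) (φ := fun _ : Fin N => ℝ)
      i).iteratedFDeriv_comp_left (x := x) hf.contDiffAt
      (i := c.partSize m) (by exact_mod_cast hc)
    simp only [Finset.sum_apply, Pi.smul_apply, smul_eq_mul]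
    rw [Finset.sum_eq_single i (by intro b _ hb; simp [hb.symm]) (by simp)]
    simp only [Pi.single_eq_same, mul_one]
    unfold mixedPartial
    change _ = iteratedFDeriv ℝ (c.partSize m)
      ((ContinuousLinearMap.proj (R := ℝ) (φ := fun _ : Fin N => ℝ) i) ∘ f) x _
    rw [h2]
    rfl
  rw [hvec, ContinuousMultilinearMap.map_sum]
  refine Finset.sum_congr rfl fun r _ => ?_
  rw [ContinuousMultilinearMap.map_smul_univ, smul_eq_mul]
  rfl

end MixedPartials

/-! ### Smoothness of superposition operators on continuous paths -/

section Superposition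

variable {K : Type*} [TopologicalSpace K] [CompactSpace K]

/-- Paths near `y` take values in one compact interval, where `f'` is uniformly continuous; the mean
value inequality then makes the remainder small uniformly in time. -/
lemma hasFDerivAt_superposition (f f' : C(ℝ, ℝ)) (hf : ∀ x, HasDerivAt f (f' x) x)
    (y : C(K, ℝ)) :
    HasFDerivAt (fun z : C(K, ℝ) => f.comp z)
      (ContinuousLinearMap.mul ℝ C(K, ℝ) (f'.comp y)) y := by
  rw [hasFDerivAt_iff_isLittleO_nhds_zero, Asymptotics.isLittleO_iff]
  intro ε hε
  have huc : UniformContinuousOn f' (Set.Icc (-(‖y‖ + 1)) (‖y‖ + 1)) :=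
    isCompact_Icc.uniformContinuousOn_of_continuous f'.continuous.continuousOn
  obtain ⟨δ, hδ, hδ'⟩ := Metric.uniformContinuousOn_iff.1 huc ε hε
  filter_upwards [Metric.ball_mem_nhds (0 : C(K, ℝ)) (lt_min hδ one_pos)] with h hh
  rw [mem_ball_zero_iff, lt_min_iff] at hh
  refine (ContinuousMap.norm_le _ (by positivity)).2 fun s => ?_
  simp only [ContinuousMap.sub_apply, ContinuousMap.comp_apply, ContinuousMap.add_apply,
    ContinuousLinearMap.mul_apply', ContinuousMap.mul_apply]
  have hy : |y s| ≤ ‖y‖ := y.norm_coe_le_norm s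
  have hs : |h s| ≤ ‖h‖ := h.norm_coe_le_norm s
  have hmv : ‖(f (y s + h s) - f' (y s) * (y s + h s)) - (f (y s) - f' (y s) * y s)‖
      ≤ ε * ‖y s + h s - y s‖ := by
    refine Convex.norm_image_sub_le_of_norm_hasDerivWithin_le
      (f := fun z => f z - f' (y s) * z) (f' := fun z => f' z - f' (y s)) (s := Set.uIcc (y s) (y s + h s))
      (fun z _ => ?_) (fun z hz => ?_) (convex_uIcc _ _) Set.left_mem_uIcc Set.right_mem_uIcc
    · simpa using ((hf z).fun_sub ((hasDerivAt_id' z).const_mul (f' (y s)))).hasDerivWithinAt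
    · have hz' : |z - y s| ≤ |h s| := by
        have := Set.abs_sub_left_of_mem_uIcc hz
        simpa using this
      have h1 := abs_le.1 hy
      have h2 := abs_le.1 (hz'.trans hs)
      refine (hδ' z ⟨by linarith, by linarith⟩ (y s) ⟨by linarith, by linarith⟩ ?_).le
      rw [Real.dist_eq]
      exact (hz'.trans hs).trans_lt hh.1
  have h3 : f (y s + h s) - f (y s) - f' (y s) * h s =
      (f (y s + h s) - f' (y s) * (y s + h s)) - (f (y s) - f' (y s) * y s) := by ring
  rw [h3]
  refine hmv.trans ?_
  simp only [add_sub_cancel_left]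
  exact mul_le_mul_of_nonneg_left hs hε.le

lemma contDiff_superposition (n : ℕ) : ∀ f : C(ℝ, ℝ), ContDiff ℝ n f →
    ContDiff ℝ n (fun z : C(K, ℝ) => f.comp z) := by
  induction n with
  | zero =>
    intro f _
    exact contDiff_zero.2 (ContinuousMap.continuous_postcomp f)
  | succ n ih =>
    intro f hf
    have hf' : ContDiff ℝ n (deriv f) := by
      have : ContDiff ℝ ((n : WithTop ℕ∞) + 1) f := by exact_mod_cast hf
      exact (contDiff_succ_iff_deriv.1 this).2.2
    let f' : C(ℝ, ℝ) := ⟨deriv f, hf'.continuous⟩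
    have hd : ∀ x, HasDerivAt f (f' x) x := fun x =>
      (hf.differentiable (by simp) x).hasDerivAt
    have h1 : ContDiff ℝ ((n : WithTop ℕ∞) + 1) (fun z : C(K, ℝ) => f.comp z) := by
      rw [contDiff_succ_iff_hasFDerivAt]
      · refine ⟨fun y => ContinuousLinearMap.mul ℝ C(K, ℝ) (f'.comp y), ?_,
          fun y => hasFDerivAt_superposition f f' hd y⟩
        have h2 : ContDiff ℝ n (fun g : C(K, ℝ) => ContinuousLinearMap.mul ℝ C(K, ℝ) g) := by
          fun_prop
        exact h2.comp (ih f' hf')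
    exact_mod_cast h1

end Superposition

/-! ### Volterra equations and their smooth solution operator -/

section Volterra

variable {a b : ℝ}

/-- The Volterra operator `f ↦ (s ↦ ∫_a^s f)` on `C([a, b])`. -/
noncomputable def volterra (hab : a ≤ b) : C(Set.Icc a b, ℝ) →L[ℝ] C(Set.Icc a b, ℝ) :=
  LinearMap.mkContinuous
    { toFun := fun f =>
        ⟨fun s => ∫ r in a..(s : ℝ), Set.IccExtend hab f r,
          (intervalIntegral.continuous_primitive
            (fun _ _ => (f.continuous.Icc_extend').intervalIntegrable _ _) a).comp
            continuous_subtype_val⟩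
      map_add' := fun f g => by
        ext s
        simp only [ContinuousMap.coe_mk, ContinuousMap.add_apply]
        rw [← intervalIntegral.integral_add
          (f.continuous.Icc_extend'.intervalIntegrable _ _)
          (g.continuous.Icc_extend'.intervalIntegrable _ _)]
        rfl
      map_smul' := fun c f => by
        ext s
        simp only [ContinuousMap.coe_mk, ContinuousMap.smul_apply, RingHom.id_apply, smul_eq_mul]
        rw [← intervalIntegral.integral_const_mul]
        rfl }
    (b - a) fun f => by
      refine (ContinuousMap.norm_le _ (mul_nonneg (sub_nonneg.2 hab) (norm_nonneg _))).2 fun s => ?_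
      have := intervalIntegral.norm_integral_le_of_norm_le_const (a := a) (b := (s : ℝ))
        (f := Set.IccExtend hab f) (C := ‖f‖) (fun r _ => f.norm_coe_le_norm _)
      refine this.trans ?_
      rw [abs_of_nonneg (sub_nonneg.2 s.2.1), mul_comm]
      exact mul_le_mul_of_nonneg_right (by linarith [s.2.2]) (norm_nonneg _)

lemma volterra_apply (hab : a ≤ b) (f : C(Set.Icc a b, ℝ)) (s : Set.Icc a b) :
    volterra hab f s = ∫ r in a..(s : ℝ), Set.IccExtend hab f r := rfl

/-- In the norm weighted by `e^{-Ls}` integration gains a factor `1/L`, whatever the length of the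
interval. -/
lemma abs_volterra_le (hab : a ≤ b) (f : C(Set.Icc a b, ℝ)) {C L : ℝ} (hL : 0 < L)
    (hf : ∀ r : Set.Icc a b, |f r| ≤ C * Real.exp (L * r)) (s : Set.Icc a b) (hC : 0 ≤ C) :
    |volterra hab f s| ≤ C / L * Real.exp (L * s) := by
  rw [volterra_apply]
  have hder : ∀ r : ℝ, HasDerivAt (fun r => C / L * Real.exp (L * r)) (C * Real.exp (L * r)) r := by
    intro r
    have := (((hasDerivAt_id r).const_mul L).exp).const_mul (C / L)
    refine this.congr_deriv ?_
    simp only [id, mul_one]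
    field_simp
  have hint : ∫ r in a..(s : ℝ), C * Real.exp (L * r) =
      C / L * Real.exp (L * s) - C / L * Real.exp (L * a) :=
    intervalIntegral.integral_eq_sub_of_hasDerivAt (fun r _ => hder r)
      (Continuous.intervalIntegrable (by fun_prop) _ _)
  have h1 : ‖∫ r in a..(s : ℝ), Set.IccExtend hab f r‖ ≤ ∫ r in a..(s : ℝ), C * Real.exp (L * r) := by
    refine intervalIntegral.norm_integral_le_of_norm_le s.2.1 ?_
      (Continuous.intervalIntegrable (by fun_prop) _ _)
    refine Filter.Eventually.of_forall fun r hr => ?_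
    have hr' : r ∈ Set.Icc a b := ⟨hr.1.le, hr.2.trans s.2.2⟩
    rw [Set.IccExtend_of_mem hab f hr']
    exact hf ⟨r, hr'⟩
  have h2 : 0 ≤ C / L * Real.exp (L * a) := by positivity
  rw [hint] at h1
  exact h1.trans (by linarith)

end Volterra

section SolutionOperator

variable {E : Type*} [NormedAddCommGroup E] [NormedSpace ℝ E] [CompleteSpace E]

/-- A contraction perturbation of the identity is a homeomorphism, and its derivative is invertible
by the Neumann series; the inverse function theorem gives the regularity of the inverse. -/
lemma exists_contDiff_inverse_id_sub {n : ℕ} (hn : 1 ≤ n) (k : E → E) (hk : ContDiff ℝ n k)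
    {c : ℝ≥0} (hc : c < 1) (hlip : LipschitzWith c k) :
    ∃ h : E ≃ₜ E, (∀ z, h z = z - k z) ∧ ContDiff ℝ n h.symm := by
  have happ : ApproximatesLinearOn (fun z => z - k z)
      ((ContinuousLinearEquiv.refl ℝ E : E ≃L[ℝ] E) : E →L[ℝ] E) Set.univ c := by
    intro x _ y _
    have := hlip.dist_le_mul x y
    rw [dist_eq_norm, dist_eq_norm] at this
    convert! this using 1
    rw [← norm_neg]
    congr 1
    simp only [ContinuousLinearEquiv.coe_refl, ContinuousLinearMap.id_apply]
    abel
  have hc' : Subsingleton E ∨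
      c < ‖(((ContinuousLinearEquiv.refl ℝ E : E ≃L[ℝ] E).symm : E ≃L[ℝ] E) : E →L[ℝ] E)‖₊⁻¹ := by
    rcases subsingleton_or_nontrivial E with h | h
    · exact Or.inl h
    · right
      have : ((ContinuousLinearEquiv.refl ℝ E).symm : E →L[ℝ] E) = ContinuousLinearMap.id ℝ E := rfl
      rw [this]
      have h1 : ‖ContinuousLinearMap.id ℝ E‖₊ = 1 := by
        ext; simp
      rw [h1]; simpa using hc
  let h : E ≃ₜ E := happ.toHomeomorph _ hc'
  have hh : ∀ z, h z = z - k z := fun z => rfl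
  refine ⟨h, hh, ?_⟩
  have hd : ∀ z, HasFDerivAt k (fderiv ℝ k z) z := fun z =>
    (hk.differentiable (by exact_mod_cast (by omega : n ≠ 0)) z).hasFDerivAt
  have hnorm : ∀ z, ‖fderiv ℝ k z‖ < 1 := fun z =>
    (norm_fderiv_le_of_lipschitz ℝ hlip).trans_lt (by exact_mod_cast hc)
  refine h.contDiff_symm (f₀' := fun z =>
    ContinuousLinearEquiv.unitsEquiv ℝ E (Units.oneSub (fderiv ℝ k z) (hnorm z))) ?_ ?_
  · intro z
    exact (hasFDerivAt_id z).sub (hd z)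
  · exact contDiff_id.sub hk

end SolutionOperator

section IntegralEquation

variable {a b : ℝ} {N : ℕ}

/-- Conjugation by `e^{Ls}` turns the integral operator into a contraction on the whole interval,
with no smallness of `b - a`. This is why the Lipschitz hypothesis is imposed at each time `s`
separately. -/
theorem exists_solution_operator (hab : a ≤ b) {n : ℕ} (hn : 1 ≤ n)
    (B : (Fin N → C(Set.Icc a b, ℝ)) → (Fin N → C(Set.Icc a b, ℝ))) (hB : ContDiff ℝ n B)
    {l : ℝ} (hlip : ∀ Y Z s i, |B Y i s - B Z i s| ≤ l * ‖fun j => Y j s - Z j s‖) :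
    ∃ S : (Fin N → C(Set.Icc a b, ℝ)) → (Fin N → C(Set.Icc a b, ℝ)), ContDiff ℝ n S ∧
      ∀ p Y, (∀ i, Y i = p i + volterra hab (B Y i)) ↔ Y = S p := by
  -- Large enough for the contraction factor `|l|/L` to be at most `1/2`, and positive even when `l
  -- = 0`.
  set L : ℝ := 2 * (|l| + 1) with hL
  have hLpos : 0 < L := by positivity
  have hlL : |l| / L ≤ 1 / 2 := by
    rw [div_le_div_iff₀ hLpos (by norm_num)]; rw [hL]; linarith
  let w : C(Set.Icc a b, ℝ) := ⟨fun s => Real.exp (L * s), by fun_prop⟩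
  let w' : C(Set.Icc a b, ℝ) := ⟨fun s => Real.exp (-(L * s)), by fun_prop⟩
  have hww' : ∀ f : C(Set.Icc a b, ℝ), w * (w' * f) = f := by
    intro f; ext s; simp [w, w', ← mul_assoc, ← Real.exp_add]
  have hw'w : ∀ f : C(Set.Icc a b, ℝ), w' * (w * f) = f := by
    intro f; ext s; simp [w, w', ← mul_assoc, ← Real.exp_add]
  let M : C(Set.Icc a b, ℝ) → (Fin N → C(Set.Icc a b, ℝ)) → (Fin N → C(Set.Icc a b, ℝ)) :=
    fun v Y i => v * Y i
  have hM : ∀ v, ContDiff ℝ n (M v) := fun v => by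
    refine contDiff_pi.2 fun i => ?_
    exact (ContinuousLinearMap.mul ℝ C(Set.Icc a b, ℝ) v).contDiff.comp (contDiff_apply ℝ _ i)
  let k : (Fin N → C(Set.Icc a b, ℝ)) → (Fin N → C(Set.Icc a b, ℝ)) :=
    fun Z i => w' * volterra hab (B (M w Z) i)
  have hk : ContDiff ℝ n k := by
    refine contDiff_pi.2 fun i => ?_
    refine (ContinuousLinearMap.mul ℝ C(Set.Icc a b, ℝ) w').contDiff.comp ?_
    refine (volterra hab).contDiff.comp ?_
    exact (contDiff_apply ℝ _ i).comp (hB.comp (hM w))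
  have hklip : LipschitzWith (1 / 2) k := by
    refine LipschitzWith.of_dist_le_mul fun Y Z => ?_
    rw [dist_eq_norm, dist_eq_norm]
    refine (pi_norm_le_iff_of_nonneg (by positivity)).2 fun i => ?_
    refine (ContinuousMap.norm_le _ (by positivity)).2 fun s => ?_
    have h1 : (k Y - k Z) i s =
        Real.exp (-(L * s)) * volterra hab (B (M w Y) i - B (M w Z) i) s := by
      simp [k, w', mul_sub]
    have h2 : ∀ r : Set.Icc a b, |(B (M w Y) i - B (M w Z) i) r| ≤
        (|l| * ‖Y - Z‖) * Real.exp (L * r) := by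
      intro r
      refine (hlip (M w Y) (M w Z) r i).trans ?_
      have h3 : ‖fun j => M w Y j r - M w Z j r‖ ≤ ‖Y - Z‖ * Real.exp (L * r) := by
        refine (pi_norm_le_iff_of_nonneg (by positivity)).2 fun j => ?_
        have h4 : M w Y j r - M w Z j r = Real.exp (L * r) * (Y - Z) j r := by
          simp [M, w, mul_sub]
        rw [h4, norm_mul, Real.norm_of_nonneg (Real.exp_pos _).le, mul_comm]
        refine mul_le_mul_of_nonneg_right ?_ (Real.exp_pos _).le
        exact (((Y - Z) j).norm_coe_le_norm r).trans (norm_le_pi_norm (Y - Z) j)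
      calc _ ≤ |l| * (‖Y - Z‖ * Real.exp (L * r)) :=
            mul_le_mul (le_abs_self l) h3 (norm_nonneg _) (abs_nonneg _)
        _ = _ := by ring
    have h5 := abs_volterra_le hab _ hLpos h2 s (by positivity)
    rw [h1, norm_mul, Real.norm_of_nonneg (Real.exp_pos _).le, Real.norm_eq_abs]
    calc _ ≤ Real.exp (-(L * s)) * (|l| * ‖Y - Z‖ / L * Real.exp (L * s)) :=
          mul_le_mul_of_nonneg_left h5 (Real.exp_pos _).le
      _ = |l| / L * ‖Y - Z‖ * (Real.exp (-(L * s)) * Real.exp (L * s)) := by ring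
      _ = |l| / L * ‖Y - Z‖ := by rw [← Real.exp_add]; simp
      _ ≤ _ := by
        have : ((1 / 2 : ℝ≥0) : ℝ) = 1 / 2 := by norm_num
        rw [this]
        exact mul_le_mul_of_nonneg_right hlL (norm_nonneg _)
  obtain ⟨h, hh, hsymm⟩ := exists_contDiff_inverse_id_sub hn k hk
    (by rw [← NNReal.coe_lt_coe]; norm_num) hklip
  refine ⟨fun p => M w (h.symm (M w' p)), (hM w).comp (hsymm.comp (hM w')), fun p Y => ?_⟩
  have hMw : ∀ Z, M w (M w' Z) = Z := fun Z => funext fun i => hww' (Z i)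
  have hMw' : ∀ Z, M w' (M w Z) = Z := fun Z => funext fun i => hw'w (Z i)
  have e1 : (Y = M w (h.symm (M w' p))) ↔ h (M w' Y) = M w' p := by
    constructor
    · intro e; rw [e, hMw']; simp
    · intro e; rw [← e]; simp [hMw]
  rw [e1, hh]
  constructor
  · intro e
    funext i
    have := e i
    simp only [Pi.sub_apply, k, hMw, M]
    rw [sub_eq_iff_eq_add, ← mul_add, ← this]
  · intro e i
    have := congrFun e i
    simp only [Pi.sub_apply, k, hMw, M] at this
    rw [← mul_sub] at this
    have h6 := congrArg (fun f => w * f) this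
    simp only [hww'] at h6
    rw [← h6]; abel

end IntegralEquation

/-! ### Maximum principle and exponential decay -/

section Decay

lemma eventually_le_of_deriv_lt {φ ψ : ℝ → ℝ} {φ' ψ' x : ℝ} (hφ : HasDerivAt φ φ' x)
    (hψ : HasDerivAt ψ ψ' x) (hle : φ x ≤ ψ x) (hlt : φ x = ψ x → φ' < ψ') :
    ∀ᶠ y in nhdsWithin x (Set.Ioi x), φ y ≤ ψ y := by
  rcases hle.lt_or_eq with h | h
  · have := hφ.continuousAt.eventually_lt hψ.continuousAt h
    exact (this.filter_mono nhdsWithin_le_nhds).mono fun y hy => hy.le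
  · have h1 := (hasDerivAt_iff_tendsto_slope.1 (hψ.fun_sub hφ))
    have h2 := h1.eventually (lt_mem_nhds (sub_pos.2 (hlt h)))
    have h3 : ∀ᶠ y in nhdsWithin x (Set.Ioi x), 0 < slope (fun t => ψ t - φ t) x y :=
      h2.filter_mono (nhdsWithin_mono _ fun y (hy : x < y) => hy.ne')
    filter_upwards [h3, self_mem_nhdsWithin] with y hy hxy
    have hxy' : 0 < y - x := sub_pos.2 hxy
    rw [slope_def_field, h, sub_self, sub_zero, lt_div_iff₀ hxy', zero_mul] at hy
    linarith

/-- A weighted maximum principle: the weight `w` is a supersolution up to the rate `ε`. -/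
lemma abs_le_of_cooperative_system {N : ℕ} {a b : ℝ} {z z' α F : Fin N → ℝ → ℝ}
    {κ : Fin N → Fin N → ℝ → ℝ} {w : Fin N → ℝ} {lam c c₀ : ℝ} (hlam : 0 < lam)
    (hw : ∀ i, 0 < w i) (hc : 0 ≤ c)
    (hz : ∀ i s, HasDerivAt (z i) (z' i s) s)
    (hode : ∀ i, ∀ s ∈ Set.Icc a b,
      z' i s = -α i s * z i s - ∑ j, κ i j s * (z i s - z j s) + F i s)
    (hα : ∀ i, ∀ s ∈ Set.Icc a b, lam ≤ α i s)
    (hκ : ∀ i j, ∀ s ∈ Set.Icc a b, 0 ≤ κ i j s)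
    (hκw : ∀ i, ∀ s ∈ Set.Icc a b, ∑ j, κ i j s * (w j - w i) ≤ lam / 4 * w i)
    (hF : ∀ i, ∀ s ∈ Set.Icc a b, |F i s| ≤ c * Real.exp (-(lam / 2) * (s - a)) * w i)
    (h₀ : ∀ i, |z i a| ≤ c₀ * w i) :
    ∀ i, ∀ s ∈ Set.Icc a b,
      |z i s| ≤ (c₀ + 4 * c / lam + 1) * Real.exp (-(lam / 2) * (s - a)) * w i := by
  -- `c₀` covers the initial data and `4c/lam` the forcing; the extra `1` makes the comparison of
  -- slopes at a contact point strict.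
  set b₀ : ℝ := c₀ + 4 * c / lam + 1 with hb₀
  rcases isEmpty_or_nonempty (Fin N) with hN | ⟨⟨i₀⟩⟩
  · exact fun i => isEmptyElim i
  have hc₀ : 0 ≤ c₀ := by
    have := (abs_nonneg _).trans (h₀ i₀)
    exact nonneg_of_mul_nonneg_left this (hw i₀)
  have hb₀pos : 0 < b₀ := by positivity
  have hcb : c < lam / 4 * b₀ := by
    have : lam / 4 * b₀ = c + lam / 4 * (c₀ + 1) := by rw [hb₀]; field_simp; ring
    rw [this]
    have : 0 < lam / 4 * (c₀ + 1) := by positivity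
    linarith
  set β : ℝ → ℝ := fun s => b₀ * Real.exp (-(lam / 2) * (s - a)) with hβ
  have hβpos : ∀ s, 0 < β s := fun s => by positivity
  have hβd : ∀ s, HasDerivAt β (-(lam / 2) * β s) s := by
    intro s
    have := ((((hasDerivAt_id' s).sub_const a).const_mul (-(lam / 2))).exp).const_mul b₀
    refine this.congr_deriv ?_
    simp only [hβ]; ring
  have hzc : ∀ i, Continuous (z i) := fun i =>
    continuous_iff_continuousAt.2 fun s => (hz i s).continuousAt
  have hβc : Continuous β := continuous_iff_continuousAt.2 fun s => (hβd s).continuousAt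
  suffices h : Set.Icc a b ⊆ {s | ∀ i, |z i s| ≤ β s * w i} from fun i s hs => h hs i
  -- Continuous induction: the set where the barrier holds is closed, contains `a`, and extends to
  -- the right of each of its points.
  refine IsClosed.Icc_subset_of_forall_exists_gt ?_ ?_ ?_
  · refine IsClosed.inter ?_ isClosed_Icc
    simp only [Set.ofPred_forall]
    exact isClosed_iInter fun i =>
      isClosed_le (hzc i).abs (hβc.mul continuous_const)
  · intro i
    refine (h₀ i).trans ?_
    simp only [hβ, sub_self, mul_zero, Real.exp_zero, mul_one]
    refine mul_le_mul_of_nonneg_right ?_ (hw i).le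
    have : 0 ≤ 4 * c / lam := by positivity
    linarith
  · rintro s ⟨hs, hsab⟩ y hy
    have hs' : s ∈ Set.Icc a b := ⟨hsab.1, hsab.2.le⟩
    have hev : ∀ i, ∀ᶠ r in nhdsWithin s (Set.Ioi s), |z i r| ≤ β r * w i := by
      intro i
      have hβw : HasDerivAt (fun r => β r * w i) (-(lam / 2) * β s * w i) s :=
        (hβd s).mul_const (w i)
      have hkey : c * Real.exp (-(lam / 2) * (s - a)) * w i < lam / 4 * β s * w i := by
        have h1 : c * Real.exp (-(lam / 2) * (s - a)) < lam / 4 * β s := by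
          simp only [hβ, ← mul_assoc]
          exact mul_lt_mul_of_pos_right hcb (Real.exp_pos _)
        exact mul_lt_mul_of_pos_right h1 (hw i)
      have hFi := abs_le.1 (hF i s hs')
      have hαi := mul_le_mul_of_nonneg_right (hα i s hs') (mul_pos (hβpos s) (hw i)).le
      have hκi := mul_le_mul_of_nonneg_left (hκw i s hs') (hβpos s).le
      rw [Finset.mul_sum] at hκi
      -- At contact, in units of `β s * w i`, damping contributes at most `-lam`, coupling at most
      -- `lam/4` and forcing less than `lam/4`: the slope lies strictly below that of the barrier.
      have hup : ∀ᶠ r in nhdsWithin s (Set.Ioi s), z i r ≤ β r * w i := by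
        refine eventually_le_of_deriv_lt (hz i s) hβw (abs_le.1 (hs i)).2 fun heq => ?_
        have hsum : -∑ j, κ i j s * (z i s - z j s) ≤ ∑ j, β s * (κ i j s * (w j - w i)) := by
          rw [← Finset.sum_neg_distrib]
          refine Finset.sum_le_sum fun j _ => ?_
          have := mul_le_mul_of_nonneg_left (abs_le.1 (hs j)).2 (hκ i j s hs')
          rw [heq]; linarith
        rw [hode i s hs', heq] at *
        linarith
      have hdown : ∀ᶠ r in nhdsWithin s (Set.Ioi s), -z i r ≤ β r * w i := by
        refine eventually_le_of_deriv_lt (hz i s).fun_neg hβw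
          (by linarith [(abs_le.1 (hs i)).1]) fun heq => ?_
        have heq' : z i s = -(β s * w i) := by linarith
        have hsum : ∑ j, κ i j s * (z i s - z j s) ≤ ∑ j, β s * (κ i j s * (w j - w i)) := by
          refine Finset.sum_le_sum fun j _ => ?_
          have := mul_le_mul_of_nonneg_left (abs_le.1 (hs j)).1 (hκ i j s hs')
          rw [heq']; linarith
        rw [hode i s hs', heq'] at *
        linarith
      filter_upwards [hup, hdown] with r h1 h2
      exact abs_le.2 ⟨by linarith, h1⟩
    have hy' : ∀ᶠ r in nhdsWithin s (Set.Ioi s), r ∈ Set.Ioc s y := Ioc_mem_nhdsGT hy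
    obtain ⟨r, hr1, hr2⟩ := ((Filter.eventually_all.2 hev).and hy').exists
    exact ⟨r, hr1, hr2⟩

/-- Decay with separation weights for a mean-field coupled linear system. -/
lemma abs_le_sepWeight_of_meanField_system {N : ℕ} {a b : ℝ} {z z' α F : Fin N → ℝ → ℝ}
    {v : Fin N → Fin N → ℝ → ℝ} {lam KV c : ℝ} {k : ℕ} (S : Finset (Fin N)) (hS : S.card ≤ k)
    (hlam : 0 < lam) (hKV : 0 ≤ KV) (hc : 0 ≤ c)
    (hz : ∀ i s, HasDerivAt (z i) (z' i s) s)
    (hode : ∀ i, ∀ s ∈ Set.Icc a b,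
      z' i s = -α i s * z i s - (N : ℝ)⁻¹ * ∑ j, v i j s * (z i s - z j s) + F i s)
    (hα : ∀ i, ∀ s ∈ Set.Icc a b, lam ≤ α i s)
    (hv : ∀ i j, ∀ s ∈ Set.Icc a b, 0 ≤ v i j s)
    (hvK : ∀ i j, ∀ s ∈ Set.Icc a b, v i j s ≤ KV)
    (hF : ∀ i, ∀ s ∈ Set.Icc a b,
      |F i s| ≤ c * Real.exp (-(lam / 2) * (s - a)) * sepWeight S {i})
    (h₀ : ∀ i, |z i a| ≤ sepWeight S {i}) :
    ∀ i, ∀ s ∈ Set.Icc a b,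
      |z i s| ≤ (2 + 4 * c / lam) * (1 + 4 * KV * k / lam) *
        Real.exp (-(lam / 2) * (s - a)) * sepWeight S {i} := by
  -- The coupling can raise the weighted sum by `KV * k * sepWeight S ∅`. Adding the same constant
  -- `M * sepWeight S ∅` to all weights leaves their differences unchanged, and this `M` makes a
  -- quarter of the damping pay for that rise.
  set M : ℝ := 4 * KV * k / lam with hM
  have hM0 : 0 ≤ M := by positivity
  set w : Fin N → ℝ := fun i => sepWeight S {i} + M * sepWeight S ∅ with hw
  have hwpos : ∀ i, 0 < w i := fun i => by
    have h1 := sepWeight_pos S {i} i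
    have h2 := sepWeight_nonneg S ∅
    positivity
  have hle : ∀ i, sepWeight S {i} ≤ w i := fun i => by
    have := mul_nonneg hM0 (sepWeight_nonneg S ∅)
    simp only [hw]; linarith
  have hge : ∀ i, w i ≤ (1 + M) * sepWeight S {i} := fun i => by
    have := mul_le_mul_of_nonneg_left
      (sepWeight_mono_right (S := S) (Finset.empty_subset {i})) hM0
    simp only [hw]; linarith
  have hq : (0 : ℝ) ≤ (N : ℝ)⁻¹ := by positivity
  have hdiff : ∀ i j, (N : ℝ)⁻¹ * (w j - w i) ≤ if j ∈ S then sepWeight S ∅ else 0 := by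
    intro i j
    have hwd : w j - w i = sepWeight S {j} - sepWeight S {i} := by simp only [hw]; ring
    have hi : sepWeight S ∅ ≤ sepWeight S {i} := sepWeight_mono_right (Finset.empty_subset _)
    rw [hwd]
    split_ifs with hj
    · have h1 : (N : ℝ)⁻¹ * sepWeight S {j} = sepWeight S ∅ := by
        unfold sepWeight
        rw [← pow_succ', Finset.sdiff_empty, Finset.sdiff_singleton_eq_erase,
          Finset.card_erase_add_one hj]
      have h2 := mul_nonneg hq (sepWeight_nonneg S {i})
      rw [mul_sub, h1]; linarith
    · have h1 : sepWeight S {j} = sepWeight S ∅ := by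
        unfold sepWeight
        rw [Finset.sdiff_empty, Finset.sdiff_singleton_eq_erase, Finset.erase_eq_of_notMem hj]
      exact mul_nonpos_of_nonneg_of_nonpos hq (by linarith)
  have key := abs_le_of_cooperative_system (a := a) (b := b) (z := z) (z' := z') (α := α) (F := F)
    (κ := fun i j s => (N : ℝ)⁻¹ * v i j s) (w := w) (lam := lam) (c := c) (c₀ := 1) hlam hwpos hc
    hz ?_ hα (fun i j s hs => mul_nonneg hq (hv i j s hs)) ?_ ?_ ?_
  · intro i s hs
    refine (key i s hs).trans ?_
    have h1 : (0 : ℝ) ≤ 4 * c / lam := by positivity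
    calc _ ≤ (1 + 4 * c / lam + 1) * Real.exp (-(lam / 2) * (s - a)) *
          ((1 + M) * sepWeight S {i}) := by
          refine mul_le_mul_of_nonneg_left (hge i) (by positivity)
      _ = _ := by ring
  · intro i s hs
    rw [hode i s hs, Finset.mul_sum]
    simp only [mul_assoc]
  · intro i s hs
    calc _ ≤ ∑ j, KV * (if j ∈ S then sepWeight S ∅ else 0) := by
          refine Finset.sum_le_sum fun j _ => ?_
          have h0 : (0 : ℝ) ≤ if j ∈ S then sepWeight S ∅ else 0 := by
            split_ifs
            · exact sepWeight_nonneg _ _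
            · exact le_rfl
          calc _ = v i j s * ((N : ℝ)⁻¹ * (w j - w i)) := by ring
            _ ≤ v i j s * (if j ∈ S then sepWeight S ∅ else 0) :=
              mul_le_mul_of_nonneg_left (hdiff i j) (hv i j s hs)
            _ ≤ _ := mul_le_mul_of_nonneg_right (hvK i j s hs) h0
      _ = KV * S.card * sepWeight S ∅ := by
          rw [← Finset.mul_sum, ← Finset.sum_filter]
          simp [mul_assoc]
      _ ≤ KV * k * sepWeight S ∅ := by
          have : (S.card : ℝ) ≤ k := by exact_mod_cast hS
          exact mul_le_mul_of_nonneg_right (mul_le_mul_of_nonneg_left this hKV)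
            (sepWeight_nonneg _ _)
      _ = lam / 4 * (M * sepWeight S ∅) := by rw [hM]; field_simp
      _ ≤ _ := by
          refine mul_le_mul_of_nonneg_left ?_ (by positivity)
          have := sepWeight_nonneg S {i}
          simp only [hw]; linarith
  · intro i s hs
    exact (hF i s hs).trans (mul_le_mul_of_nonneg_left (hle i) (by positivity))
  · intro i
    rw [one_mul]
    exact (h₀ i).trans (hle i)

end Decay

/-! ### Remainder in Faà di Bruno's formula and linearity of mixed partials -/

section FaaDiBrunoRemainder

variable {N : ℕ}

lemma OrderedFinpartition.sum_partSize {n : ℕ} (c : OrderedFinpartition n) :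
    ∑ m, c.partSize m = n := by
  simpa using c.sum_sigma_eq_sum (fun _ => (1 : ℕ))

lemma OrderedFinpartition.partSize_lt {n : ℕ} (c : OrderedFinpartition n) (hc : 2 ≤ c.length)
    (m : Fin c.length) : c.partSize m < n := by
  have h1 := c.sum_partSize
  have : Nontrivial (Fin c.length) := Fin.nontrivial_iff_two_le.2 hc
  obtain ⟨m', hm'⟩ := exists_ne m
  have h2 : c.partSize m + c.partSize m' ≤ ∑ m, c.partSize m := by
    rw [← Finset.sum_pair hm'.symm]
    exact Finset.sum_le_sum_of_subset (Finset.subset_univ _)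
  have := c.partSize_pos m'
  omega

lemma iteratedDeriv_sub_linear {n : ℕ} {h : ℝ → ℝ} (hh : ContDiff ℝ n h) (d : ℝ) {k : ℕ}
    (hk : 2 ≤ k) (hkn : k ≤ n) (y : ℝ) :
    iteratedDeriv k (fun t => h t - d * t) y = iteratedDeriv k h y := by
  have h1 : ContDiffAt ℝ k (fun t : ℝ => d * t) y := by fun_prop
  have h2 : ContDiffAt ℝ k h y := (hh.of_le (by exact_mod_cast hkn)).contDiffAt
  rw [iteratedDeriv_fun_sub h2 h1]
  have h3 : iteratedDeriv k (fun t : ℝ => d * t) y = 0 := by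
    obtain ⟨m, rfl⟩ : ∃ m, k = m + 1 + 1 := ⟨k - 2, by omega⟩
    have e1 : deriv (fun t : ℝ => d * t) = fun _ => d := by
      funext t
      simp
    have e2 : deriv (fun _ : ℝ => d) = fun _ => (0 : ℝ) := by funext t; simp
    rw [iteratedDeriv_succ', iteratedDeriv_succ', e1, e2]
    simp
  rw [h3, sub_zero]

/-- Once the top-order term is removed, every partition left has at least two blocks, hence only
derivatives of order below `n`. As `θ ≤ 1`, the product over blocks still carries one factor `θ`. -/
lemma abs_mixedPartial_comp_sub_le {n : ℕ} (hn : 1 ≤ n) (γ : Fin n → Fin N) {h : ℝ → ℝ}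
    {f : (Fin N → ℝ) → ℝ} (hh : ContDiff ℝ n h) (hf : ContDiff ℝ n f) (x : Fin N → ℝ)
    {H A θ : ℝ} (hH : ∀ k, 2 ≤ k → k ≤ n → ∀ y, |iteratedDeriv k h y| ≤ H) (hH0 : 0 ≤ H)
    (hA : 1 ≤ A) (hθ : 0 ≤ θ) (hθ1 : θ ≤ 1) (R : Finset (Fin N))
    (hbd : ∀ m, 1 ≤ m → m < n → ∀ δ : Fin m → Fin N,
      |mixedPartial δ f x| ≤ A * θ * sepWeight (Finset.univ.image δ) R) :
    |mixedPartial γ (fun y => h (f y)) x - deriv h (f x) * mixedPartial γ f x| ≤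
      Fintype.card (OrderedFinpartition n) * (H * A ^ n) * θ *
        sepWeight (Finset.univ.image γ) R := by
  -- Subtracting the linear function with slope frozen at `f x` kills exactly the one-block
  -- partition and leaves all higher derivatives of `h` unchanged.
  set d := deriv h (f x) with hd
  have hlin : ContDiff ℝ n (fun t : ℝ => d * t) := by fun_prop
  have e1 : mixedPartial γ (fun y => h (f y)) x - d * mixedPartial γ f x =
      mixedPartial γ (fun y => (fun t => h t - d * t) (f y)) x := by
    unfold mixedPartial
    have h1 : ContDiff ℝ n (fun y => h (f y)) := hh.comp hf
    have h2 : ContDiff ℝ n (fun y => d • f y) := hf.const_smul d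
    have h3 := iteratedFDeriv_const_smul_apply (𝕜 := ℝ) (i := n) (a := d) (x := x) hf.contDiffAt
    have h4 : iteratedFDeriv ℝ n ((fun y => h (f y)) - fun y => d • f y) x =
        iteratedFDeriv ℝ n (fun y => h (f y)) x - iteratedFDeriv ℝ n (fun y => d • f y) x :=
      iteratedFDeriv_sub_apply h1.contDiffAt h2.contDiffAt
    change _ = iteratedFDeriv ℝ n ((fun y => h (f y)) - fun y => d • f y) x _
    rw [h4]
    have h5 : iteratedFDeriv ℝ n (fun y => d • f y) x = d • iteratedFDeriv ℝ n f x := h3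
    rw [h5]
    rfl
  rw [e1, mixedPartial_comp γ (hh.sub hlin) hf]
  refine (Finset.abs_sum_le_sum_abs _ _).trans ?_
  have hterm : ∀ c : OrderedFinpartition n,
      |iteratedDeriv c.length (fun t => h t - d * t) (f x) *
        ∏ m, mixedPartial (γ ∘ c.emb m) f x| ≤
      H * A ^ n * θ * sepWeight (Finset.univ.image γ) R := by
    intro c
    have hw := sepWeight_nonneg (Finset.univ.image γ) R
    have hpos : 1 ≤ c.length := c.length_pos hn
    rcases hpos.eq_or_lt with h1 | h1
    · have : iteratedDeriv c.length (fun t => h t - d * t) (f x) = 0 := by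
        rw [← h1, iteratedDeriv_one]
        have hdh : HasDerivAt h d (f x) :=
          (hh.differentiable (by exact_mod_cast (by omega : n ≠ 0)) (f x)).hasDerivAt
        have := hdh.fun_sub ((hasDerivAt_id' (f x)).const_mul d)
        simpa using this.deriv
      rw [this, zero_mul, abs_zero]
      positivity
    · rw [iteratedDeriv_sub_linear hh d h1 c.length_le, abs_mul, Finset.abs_prod]
      have hprod : ∏ m, |mixedPartial (γ ∘ c.emb m) f x| ≤
          A ^ n * θ * sepWeight (Finset.univ.image γ) R := by
        calc _ ≤ ∏ m, (A * θ * sepWeight (Finset.univ.image (γ ∘ c.emb m)) R) :=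
              Finset.prod_le_prod (fun _ _ => abs_nonneg _) fun m _ =>
                hbd _ (c.partSize_pos m) (c.partSize_lt h1 m) _
          _ = (A ^ c.length * θ ^ c.length) *
              ∏ m, sepWeight (Finset.univ.image (γ ∘ c.emb m)) R := by
              rw [Finset.prod_mul_distrib]; simp [mul_pow]
          _ ≤ (A ^ n * θ) * sepWeight (Finset.univ.image γ) R := by
              refine mul_le_mul ?_ (prod_sepWeight_le γ c R)
                (Finset.prod_nonneg fun _ _ => sepWeight_nonneg _ _) (by positivity)
              refine mul_le_mul (pow_le_pow_right₀ hA c.length_le) ?_ (by positivity) (by positivity)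
              exact pow_le_of_le_one hθ hθ1 (by omega)
          _ = _ := rfl
      calc _ ≤ H * (A ^ n * θ * sepWeight (Finset.univ.image γ) R) :=
            mul_le_mul (hH _ h1 c.length_le _) hprod
              (Finset.prod_nonneg fun _ _ => abs_nonneg _) hH0
        _ = _ := by ring
  refine (Finset.sum_le_sum fun c _ => hterm c).trans ?_
  rw [Finset.sum_const, nsmul_eq_mul, Finset.card_univ]
  apply le_of_eq; ring

/-- This is the initial value of the differentiated flow. It is nonzero only at first order in
direction `i`, where the weight is `1`. -/
lemma abs_mixedPartial_add_coord_le {n : ℕ} (hn : 1 ≤ n) (γ : Fin n → Fin N) (i : Fin N) (p : ℝ)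
    (x : Fin N → ℝ) :
    |mixedPartial γ (fun y => p + y i) x| ≤ sepWeight (Finset.univ.image γ) {i} := by
  have hfd : fderiv ℝ (fun y : Fin N → ℝ => p + y i) =
      fun _ => ContinuousLinearMap.proj (R := ℝ) (φ := fun _ : Fin N => ℝ) i := by
    funext y
    exact ((ContinuousLinearMap.proj (R := ℝ) (φ := fun _ : Fin N => ℝ)
      i).hasFDerivAt.const_add p).fderiv
  obtain ⟨m, rfl⟩ : ∃ m, n = m + 1 := ⟨n - 1, by omega⟩
  unfold mixedPartial
  rw [iteratedFDeriv_succ_apply_right, hfd]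
  rcases Nat.eq_zero_or_pos m with rfl | hm
  · rw [iteratedFDeriv_zero_apply]
    simp only [ContinuousLinearMap.proj_apply]
    by_cases h : γ (Fin.last 0) = i
    · have : Finset.univ.image γ \ {i} = ∅ := by
        rw [Finset.sdiff_eq_empty_iff_subset]
        intro j hj
        obtain ⟨k, -, rfl⟩ := Finset.mem_image.1 hj
        rw [Finset.mem_singleton, ← h]
        exact congrArg γ (Subsingleton.elim (α := Fin 1) _ _)
      have h1 : sepWeight (Finset.univ.image γ) {i} = 1 := by rw [sepWeight, this]; simp
      rw [h1, h]; simp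
    · have : (Pi.single (γ (Fin.last 0)) (1 : ℝ) : Fin N → ℝ) i = 0 :=
        Pi.single_eq_of_ne (Ne.symm h) _
      rw [this, abs_zero]
      exact sepWeight_nonneg _ _
  · rw [iteratedFDeriv_const_of_ne hm.ne']
    simpa using sepWeight_nonneg _ _

end FaaDiBrunoRemainder

section MixedPartialLinearity

variable {N n : ℕ} (γ : Fin n → Fin N) {f g : (Fin N → ℝ) → ℝ} (x : Fin N → ℝ)

lemma mixedPartial_clm_comp {G : Type*} [NormedAddCommGroup G] [NormedSpace ℝ G] (L : G →L[ℝ] ℝ)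
    {f : (Fin N → ℝ) → G} (hf : ContDiff ℝ n f) :
    mixedPartial γ (fun y => L (f y)) x =
      L (iteratedFDeriv ℝ n f x fun k => Pi.single (γ k) 1) := by
  have := L.iteratedFDeriv_comp_left (x := x) hf.contDiffAt (i := n) le_rfl
  change iteratedFDeriv ℝ n (L ∘ f) x _ = _
  rw [this]
  rfl

lemma mixedPartial_sub (hf : ContDiff ℝ n f) (hg : ContDiff ℝ n g) :
    mixedPartial γ (fun y => f y - g y) x = mixedPartial γ f x - mixedPartial γ g x := by
  have : iteratedFDeriv ℝ n (f - g) x = iteratedFDeriv ℝ n f x - iteratedFDeriv ℝ n g x :=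
    iteratedFDeriv_sub_apply hf.contDiffAt hg.contDiffAt
  change iteratedFDeriv ℝ n (f - g) x _ = _
  rw [this]
  rfl

lemma mixedPartial_const_mul (c : ℝ) (hf : ContDiff ℝ n f) :
    mixedPartial γ (fun y => c * f y) x = c * mixedPartial γ f x :=
  mixedPartial_clm_comp γ x (c • ContinuousLinearMap.id ℝ ℝ) hf

lemma mixedPartial_neg (hf : ContDiff ℝ n f) :
    mixedPartial γ (fun y => -f y) x = -mixedPartial γ f x :=
  mixedPartial_clm_comp γ x (-ContinuousLinearMap.id ℝ ℝ) hf

lemma mixedPartial_sum {ι : Type*} (s : Finset ι) {f : ι → (Fin N → ℝ) → ℝ}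
    (hf : ∀ i ∈ s, ContDiff ℝ n (f i)) :
    mixedPartial γ (fun y => ∑ i ∈ s, f i y) x = ∑ i ∈ s, mixedPartial γ (f i) x := by
  have : iteratedFDeriv ℝ n (fun y => ∑ i ∈ s, f i y) x = ∑ i ∈ s, iteratedFDeriv ℝ n (f i) x := by
    exact iteratedFDeriv_fun_sum_apply (𝕜 := ℝ) fun i hi => (hf i hi).contDiffAt
  unfold mixedPartial
  rw [this]
  simp

end MixedPartialLinearity

/-! ### The drift as a smooth operator on paths -/

section Flow

variable {K : Type*} [TopologicalSpace K]

/-- The drift of the particle system as an operator on paths; `fU` and `fV` stand for the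
derivatives of the potentials. -/
noncomputable def driftOp (fU fV : C(ℝ, ℝ)) {N : ℕ} (Y : Fin N → C(K, ℝ)) (i : Fin N) : C(K, ℝ) :=
  -fU.comp (Y i) - (N : ℝ)⁻¹ • ∑ j, fV.comp (Y i - Y j)

lemma driftOp_apply (fU fV : C(ℝ, ℝ)) {N : ℕ} (Y : Fin N → C(K, ℝ)) (i : Fin N) (s : K) :
    driftOp fU fV Y i s = -fU (Y i s) - (N : ℝ)⁻¹ * ∑ j, fV (Y i s - Y j s) := by
  simp [driftOp]

lemma abs_driftOp_sub_le {fU fV : C(ℝ, ℝ)} {LU LV : ℝ≥0} (hU : LipschitzWith LU fU)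
    (hV : LipschitzWith LV fV) {N : ℕ} (Y Z : Fin N → C(K, ℝ)) (s : K) (i : Fin N) :
    |driftOp fU fV Y i s - driftOp fU fV Z i s| ≤ (LU + 2 * LV) * ‖fun j => Y j s - Z j s‖ := by
  set D := ‖fun j => Y j s - Z j s‖ with hD
  have hcoord : ∀ j, |Y j s - Z j s| ≤ D := fun j => norm_le_pi_norm (fun j => Y j s - Z j s) j
  have h1 : |fU (Z i s) - fU (Y i s)| ≤ LU * D := by
    have := hU.dist_le_mul (Z i s) (Y i s)
    rw [Real.dist_eq, Real.dist_eq, abs_sub_comm (Z i s)] at this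
    exact this.trans (mul_le_mul_of_nonneg_left (hcoord i) LU.2)
  have h2 : ∀ j, |fV (Z i s - Z j s) - fV (Y i s - Y j s)| ≤ 2 * LV * D := by
    intro j
    have := hV.dist_le_mul (Z i s - Z j s) (Y i s - Y j s)
    rw [Real.dist_eq, Real.dist_eq] at this
    have h3 : |Z i s - Z j s - (Y i s - Y j s)| ≤ D + D := by
      have e : Z i s - Z j s - (Y i s - Y j s) = -(Y i s - Z i s) + (Y j s - Z j s) := by ring
      rw [e]
      exact (abs_add_le _ _).trans (add_le_add (by rw [abs_neg]; exact hcoord i) (hcoord j))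
    calc _ ≤ LV * (D + D) := this.trans (mul_le_mul_of_nonneg_left h3 LV.2)
      _ = _ := by ring
  have e : driftOp fU fV Y i s - driftOp fU fV Z i s = (fU (Z i s) - fU (Y i s)) +
      (N : ℝ)⁻¹ * ∑ j, (fV (Z i s - Z j s) - fV (Y i s - Y j s)) := by
    rw [driftOp_apply, driftOp_apply, Finset.sum_sub_distrib]; ring
  have h4 : |(N : ℝ)⁻¹ * ∑ j, (fV (Z i s - Z j s) - fV (Y i s - Y j s))| ≤ 2 * LV * D := by
    rw [abs_mul, abs_of_nonneg (by positivity : (0 : ℝ) ≤ (N : ℝ)⁻¹)]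
    calc _ ≤ (N : ℝ)⁻¹ * ∑ _j : Fin N, 2 * LV * D := by
          refine mul_le_mul_of_nonneg_left ?_ (by positivity)
          exact (Finset.abs_sum_le_sum_abs _ _).trans (Finset.sum_le_sum fun j _ => h2 j)
      _ = (N * (N : ℝ)⁻¹) * (2 * LV * D) := by simp; ring
      _ ≤ 1 * (2 * LV * D) := mul_le_mul_of_nonneg_right (natCast_mul_inv_le_one N) (by positivity)
      _ = _ := one_mul _
  rw [e]
  calc _ ≤ LU * D + 2 * LV * D := (abs_add_le _ _).trans (add_le_add h1 h4)
    _ = _ := by ring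

variable [CompactSpace K]

lemma contDiff_path_apply {N n : ℕ} {Φ : (Fin N → ℝ) → Fin N → C(K, ℝ)} (hΦ : ContDiff ℝ n Φ)
    (i : Fin N) (s : K) : ContDiff ℝ n (fun y => Φ y i s) := by
  have hL : ContDiff ℝ n (fun f : C(K, ℝ) => ContinuousMap.evalCLM ℝ s f) := by fun_prop
  exact hL.comp ((contDiff_apply ℝ C(K, ℝ) i).comp hΦ)

lemma contDiff_driftOp {n : ℕ} {fU fV : C(ℝ, ℝ)} (hU : ContDiff ℝ n fU) (hV : ContDiff ℝ n fV)
    (N : ℕ) : ContDiff ℝ n (driftOp (K := K) fU fV (N := N)) := by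
  refine contDiff_pi.2 fun i => ?_
  have h1 := contDiff_superposition (K := K) n fU hU
  have h2 := contDiff_superposition (K := K) n fV hV
  have h3 : ∀ i : Fin N, ContDiff ℝ n (fun Y : Fin N → C(K, ℝ) => Y i) :=
    fun i => contDiff_apply ℝ _ i
  exact ((h1.comp (h3 i)).neg).sub
    ((ContDiff.sum fun j _ => h2.comp ((h3 i).sub (h3 j))).const_smul _)

end Flow

/-! ### Weighted decay of the derivatives of the flow -/

section FlowDerivatives

/-- The properties of the derivatives `fU` of the confining potential and `fV` of the interaction
potential on which the estimates of the flow rest. -/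
structure ForceBounds (fU fV : C(ℝ, ℝ)) (lam KV H : ℝ) : Prop where
  contDiff_fU : ContDiff ℝ 6 fU
  contDiff_fV : ContDiff ℝ 6 fV
  lam_pos : 0 < lam
  KV_nonneg : 0 ≤ KV
  le_deriv_fU : ∀ y, lam ≤ deriv fU y
  deriv_fV_nonneg : ∀ y, 0 ≤ deriv fV y
  deriv_fV_le : ∀ y, deriv fV y ≤ KV
  H_nonneg : 0 ≤ H
  bound_fU : ∀ k, 2 ≤ k → k ≤ 6 → ∀ y, |iteratedDeriv k fU y| ≤ H
  bound_fV : ∀ k, 2 ≤ k → k ≤ 6 → ∀ y, |iteratedDeriv k fV y| ≤ H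

/-- Induction step on the order: the top-order derivatives solve the damped mean-field system,
forced by Faà di Bruno remainders which the bounds of lower order control. `C` is fixed before `N`,
the interval and the driving path `p`. -/
lemma exists_abs_mixedPartial_flow_le_succ {fU fV : C(ℝ, ℝ)} {lam KV H : ℝ}
    (hf : ForceBounds fU fV lam KV H) {n : ℕ} (hn : 1 ≤ n) (hn6 : n ≤ 6) {A : ℝ} (hA : 1 ≤ A) :
    ∃ C : ℝ, ∀ (N : ℕ) (a b : ℝ) (hab : a ≤ b) (p : Fin N → C(Set.Icc a b, ℝ))
      (Φ : (Fin N → ℝ) → Fin N → C(Set.Icc a b, ℝ)), ContDiff ℝ 6 Φ →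
      (∀ x i, Φ x i = p i + ContinuousMap.const _ (x i) + volterra hab (driftOp fU fV (Φ x) i)) →
      (∀ m, 1 ≤ m → m < n → ∀ (γ : Fin m → Fin N) x i s, |mixedPartial γ (fun y => Φ y i s) x| ≤
        A * Real.exp (-(lam / 2) * (s - a)) * sepWeight (Finset.univ.image γ) {i}) →
      ∀ (γ : Fin n → Fin N) x i s, |mixedPartial γ (fun y => Φ y i s) x| ≤
        C * Real.exp (-(lam / 2) * (s - a)) * sepWeight (Finset.univ.image γ) {i} := by
  set c₁ : ℝ := Fintype.card (OrderedFinpartition n) * (H * A ^ n) with hc₁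
  -- The interaction acts on `Φ i - Φ j`, whose lower derivatives obey the bound with constant `2 *
  -- A`.
  set c₂ : ℝ := Fintype.card (OrderedFinpartition n) * (H * (2 * A) ^ n) with hc₂
  have hH := hf.H_nonneg
  have hlam := hf.lam_pos
  have hc₁0 : 0 ≤ c₁ := by positivity
  have hc₂0 : 0 ≤ c₂ := by positivity
  set c : ℝ := c₁ + c₂ * (1 + n) with hc
  have hc0 : 0 ≤ c := by positivity
  refine ⟨(2 + 4 * c / lam) * (1 + 4 * KV * n / lam), ?_⟩
  intro N a b hab p Φ hΦ heq ih γ x i₀ s₀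
  have h6 : ((n : ℕ) : WithTop ℕ∞) ≤ 6 := by exact_mod_cast hn6
  have hΦn : ContDiff ℝ n Φ := hΦ.of_le h6
  have hfU : ContDiff ℝ n fU := hf.contDiff_fU.of_le h6
  have hfV : ContDiff ℝ n fV := hf.contDiff_fV.of_le h6
  have hΦs : ∀ i (s : Set.Icc a b), ContDiff ℝ n (fun y => Φ y i s) := fun i s =>
    contDiff_path_apply hΦn i s
  set S := Finset.univ.image γ with hS
  have hScard : S.card ≤ n := Finset.card_image_le.trans (by simp)
  have hDop : ∀ i, ContDiff ℝ n (fun y => driftOp fU fV (Φ y) i) := fun i =>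
    (contDiff_apply ℝ _ i).comp ((contDiff_driftOp hfU hfV N).comp hΦn)
  -- Differentiating in path space yields a continuous path at once, so the fundamental theorem of
  -- calculus applies to its primitive.
  let G : Fin N → C(Set.Icc a b, ℝ) := fun i =>
    iteratedFDeriv ℝ n (fun y => driftOp fU fV (Φ y) i) x fun k => Pi.single (γ k) 1
  have hG : ∀ i s, G i s = mixedPartial γ (fun y => driftOp fU fV (Φ y) i s) x := fun i s =>
    (mixedPartial_clm_comp γ x (ContinuousMap.evalCLM ℝ s) (hDop i)).symm
  let P : ℝ → Set.Icc a b := Set.projIcc a b hab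
  -- Extension beyond `[a,b]` makes `z` differentiable on the whole line. Evaluating `p i` at `s₀`
  -- is harmless: derivatives of order `n ≥ 1` ignore constants.
  let z : Fin N → ℝ → ℝ := fun i s =>
    mixedPartial γ (fun y => p i s₀ + y i) x + ∫ r in a..s, Set.IccExtend hab (G i) r
  have hz : ∀ i s, HasDerivAt (z i) (G i (P s)) s := fun i s =>
    ((G i).continuous.Icc_extend'.integral_hasStrictDerivAt a s).hasDerivAt.const_add _
  have haff : ∀ i (t : ℝ), ContDiff ℝ n (fun y : Fin N → ℝ => t + y i) := fun i t => by fun_prop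
  have hzeq : ∀ i (s : Set.Icc a b), z i s = mixedPartial γ (fun y => Φ y i s) x := by
    intro i s
    have e1 : (fun y => Φ y i s) = fun y => (p i s + y i) -
        (-((ContinuousMap.evalCLM ℝ s).comp (volterra hab))) (driftOp fU fV (Φ y) i) := by
      funext y
      conv_lhs => rw [heq y i]
      simp
    have e2 : ∀ t t' : ℝ, mixedPartial γ (fun y : Fin N → ℝ => t + y i) x =
        mixedPartial γ (fun y => t' + y i) x := by
      intro t t'
      have e3 : (fun y : Fin N → ℝ => t + y i) = fun y => (t' + y i) - (fun _ => t' - t) y := by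
        funext y; ring
      rw [e3, mixedPartial_sub γ x (haff i t') contDiff_const]
      have e4 : mixedPartial γ (fun _ : Fin N → ℝ => t' - t) x = 0 := by
        unfold mixedPartial
        rw [iteratedFDeriv_const_of_ne (by omega)]
        rfl
      rw [e4, sub_zero]
    have hlin : ContDiff ℝ n fun y =>
        (-((ContinuousMap.evalCLM ℝ s).comp (volterra hab))) (driftOp fU fV (Φ y) i) :=
      ContDiff.clm_apply contDiff_const (hDop i)
    rw [e1, mixedPartial_sub γ x (haff i _) hlin, mixedPartial_clm_comp γ x _ (hDop i)]
    simp only [z, e2 (p i s) (p i s₀), neg_apply,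
      ContinuousLinearMap.comp_apply, sub_neg_eq_add]
    rfl
  let α : Fin N → ℝ → ℝ := fun i s => deriv fU (Φ x i (P s))
  let v : Fin N → Fin N → ℝ → ℝ := fun i j s => deriv fV (Φ x i (P s) - Φ x j (P s))
  -- Defined as whatever makes the linear equation hold; `hFe` below identifies it with the
  -- remainders.
  let F : Fin N → ℝ → ℝ := fun i s =>
    G i (P s) + α i s * z i s + (N : ℝ)⁻¹ * ∑ j, v i j s * (z i s - z j s)
  have hF : ∀ i, ∀ s ∈ Set.Icc a b,
      |F i s| ≤ c * Real.exp (-(lam / 2) * (s - a)) * sepWeight S {i} := by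
    intro i s hs
    set σ : Set.Icc a b := ⟨s, hs⟩ with hσ
    have hP : P s = σ := Set.projIcc_of_mem hab hs
    have hzs : ∀ j, z j s = mixedPartial γ (fun y => Φ y j σ) x := fun j => hzeq j σ
    set θ := Real.exp (-(lam / 2) * (s - a)) with hθ
    have hθ0 : 0 ≤ θ := (Real.exp_pos _).le
    have hθ1 : θ ≤ 1 := Real.exp_le_one_iff.2
      (mul_nonpos_of_nonpos_of_nonneg (by linarith) (by linarith [hs.1]))
    have hVc : ∀ j, ContDiff ℝ n (fun y => fV (Φ y i σ - Φ y j σ)) := fun j =>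
      hfV.comp ((hΦs i σ).sub (hΦs j σ))
    have hGs : G i σ = -mixedPartial γ (fun y => fU (Φ y i σ)) x -
        (N : ℝ)⁻¹ * ∑ j, mixedPartial γ (fun y => fV (Φ y i σ - Φ y j σ)) x := by
      rw [hG]
      simp only [driftOp_apply]
      have hs : ContDiff ℝ n (fun y => ∑ j, fV (Φ y i σ - Φ y j σ)) :=
        ContDiff.sum fun j _ => hVc j
      have hu : ContDiff ℝ n (fun y => fU (Φ y i σ)) := hfU.comp (hΦs i σ)
      rw [mixedPartial_sub γ x hu.neg (contDiff_const.mul hs), mixedPartial_neg γ x hu,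
        mixedPartial_const_mul γ x _ hs, mixedPartial_sum γ x _ fun j _ => hVc j]
    have hFe : F i s = -(mixedPartial γ (fun y => fU (Φ y i σ)) x -
          deriv fU (Φ x i σ) * mixedPartial γ (fun y => Φ y i σ) x) -
        (N : ℝ)⁻¹ * ∑ j, (mixedPartial γ (fun y => fV (Φ y i σ - Φ y j σ)) x -
          deriv fV (Φ x i σ - Φ x j σ) * mixedPartial γ (fun y => Φ y i σ - Φ y j σ) x) := by
      simp only [F, α, v, hP, hGs, hzs]
      have : ∀ j, mixedPartial γ (fun y => Φ y i σ - Φ y j σ) x =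
          mixedPartial γ (fun y => Φ y i σ) x - mixedPartial γ (fun y => Φ y j σ) x := fun j =>
        mixedPartial_sub γ x (hΦs i σ) (hΦs j σ)
      simp only [this, Finset.sum_sub_distrib]
      ring
    have h1 := abs_mixedPartial_comp_sub_le hn γ hfU (hΦs i σ) x (H := H) (A := A) (θ := θ)
      (fun k hk hkn => hf.bound_fU k hk (hkn.trans hn6)) hH hA hθ0 hθ1 {i}
      (fun m hm hmn δ => ih m hm hmn δ x i σ)
    have h2 : ∀ j, |mixedPartial γ (fun y => fV (Φ y i σ - Φ y j σ)) x -
          deriv fV (Φ x i σ - Φ x j σ) * mixedPartial γ (fun y => Φ y i σ - Φ y j σ) x| ≤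
        c₂ * θ * sepWeight S {i, j} := by
      intro j
      refine abs_mixedPartial_comp_sub_le hn γ hfV ((hΦs i σ).sub (hΦs j σ)) x (H := H)
        (A := 2 * A) (θ := θ) (fun k hk hkn => hf.bound_fV k hk (hkn.trans hn6)) hH
        (by linarith) hθ0 hθ1 {i, j} (fun m hm hmn δ => ?_)
      have hmn' : ((m : ℕ) : WithTop ℕ∞) ≤ n := by exact_mod_cast hmn.le
      rw [mixedPartial_sub δ x ((hΦs i σ).of_le hmn') ((hΦs j σ).of_le hmn')]
      have hi : sepWeight (Finset.univ.image δ) {i} ≤ sepWeight (Finset.univ.image δ) {i, j} :=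
        sepWeight_mono_right (by simp)
      have hj : sepWeight (Finset.univ.image δ) {j} ≤ sepWeight (Finset.univ.image δ) {i, j} :=
        sepWeight_mono_right (by simp)
      have hAθ : 0 ≤ A * θ := by positivity
      calc _ ≤ A * θ * sepWeight (Finset.univ.image δ) {i} +
            A * θ * sepWeight (Finset.univ.image δ) {j} :=
            (abs_sub _ _).trans (add_le_add (ih m hm hmn δ x i σ) (ih m hm hmn δ x j σ))
        _ ≤ A * θ * sepWeight (Finset.univ.image δ) {i, j} +
            A * θ * sepWeight (Finset.univ.image δ) {i, j} :=
            add_le_add (mul_le_mul_of_nonneg_left hi hAθ) (mul_le_mul_of_nonneg_left hj hAθ)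
        _ = _ := by ring
    have h3 : |(N : ℝ)⁻¹ * ∑ j, (mixedPartial γ (fun y => fV (Φ y i σ - Φ y j σ)) x -
          deriv fV (Φ x i σ - Φ x j σ) * mixedPartial γ (fun y => Φ y i σ - Φ y j σ) x)| ≤
        c₂ * (1 + n) * θ * sepWeight S {i} := by
      rw [abs_mul, abs_of_nonneg (by positivity : (0 : ℝ) ≤ (N : ℝ)⁻¹)]
      calc _ ≤ (N : ℝ)⁻¹ * ∑ j, c₂ * θ * sepWeight S {i, j} := by
            refine mul_le_mul_of_nonneg_left ?_ (by positivity)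
            exact (Finset.abs_sum_le_sum_abs _ _).trans (Finset.sum_le_sum fun j _ => h2 j)
        _ = c₂ * θ * ((N : ℝ)⁻¹ * ∑ j, sepWeight S {i, j}) := by
            rw [← Finset.mul_sum]; ring
        _ ≤ c₂ * θ * ((1 + S.card) * sepWeight S {i}) :=
            mul_le_mul_of_nonneg_left (sum_sepWeight_pair_le S i) (by positivity)
        _ ≤ c₂ * θ * ((1 + n) * sepWeight S {i}) := by
            have : (S.card : ℝ) ≤ n := by exact_mod_cast hScard
            have := sepWeight_nonneg S {i}
            gcongr
        _ = _ := by ring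
    rw [hFe]
    calc _ ≤ c₁ * θ * sepWeight S {i} + c₂ * (1 + n) * θ * sepWeight S {i} := by
          refine (abs_sub _ _).trans (add_le_add ?_ h3)
          rw [abs_neg]
          exact h1
      _ = _ := by rw [hc]; ring
  have key := abs_le_sepWeight_of_meanField_system (a := a) (b := b) (z := z)
    (z' := fun i s => G i (P s)) (α := α) (F := F) (v := v) S hScard hlam hf.KV_nonneg hc0 hz
    (fun i s _ => by simp only [F]; ring) (fun i s _ => hf.le_deriv_fU _)
    (fun i j s _ => hf.deriv_fV_nonneg _) (fun i j s _ => hf.deriv_fV_le _) hF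
    (fun i => by
      simp only [z, intervalIntegral.integral_same, add_zero]
      exact abs_mixedPartial_add_coord_le hn γ i _ x)
    i₀ s₀ s₀.2
  rwa [hzeq] at key

theorem exists_abs_mixedPartial_flow_le {fU fV : C(ℝ, ℝ)} {lam KV H : ℝ}
    (hf : ForceBounds fU fV lam KV H) {n : ℕ} (hn6 : n ≤ 6) :
    ∃ C : ℝ, 1 ≤ C ∧ ∀ (N : ℕ) (a b : ℝ) (hab : a ≤ b) (p : Fin N → C(Set.Icc a b, ℝ))
      (Φ : (Fin N → ℝ) → Fin N → C(Set.Icc a b, ℝ)), ContDiff ℝ 6 Φ →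
      (∀ x i, Φ x i = p i + ContinuousMap.const _ (x i) + volterra hab (driftOp fU fV (Φ x) i)) →
      ∀ m, 1 ≤ m → m ≤ n → ∀ (γ : Fin m → Fin N) x i s, |mixedPartial γ (fun y => Φ y i s) x| ≤
        C * Real.exp (-(lam / 2) * (s - a)) * sepWeight (Finset.univ.image γ) {i} := by
  induction n with
  | zero => exact ⟨1, le_rfl, fun N a b hab p Φ _ _ m hm hm0 => by omega⟩
  | succ n ih =>
    obtain ⟨A, hA, hAbd⟩ := ih (by omega)
    obtain ⟨C, hC⟩ := exists_abs_mixedPartial_flow_le_succ hf (Nat.le_add_left 1 n) hn6 hA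
    refine ⟨max A C, le_max_of_le_left hA, ?_⟩
    intro N a b hab p Φ hΦ heq m hm hmn γ x i s
    have hw := sepWeight_nonneg (Finset.univ.image γ) {i}
    rcases hmn.eq_or_lt with rfl | hlt
    · refine (hC N a b hab p Φ hΦ heq
        (fun m hm hmn => hAbd N a b hab p Φ hΦ heq m hm (by omega)) γ x i s).trans ?_
      gcongr
      exact le_max_right _ _
    · refine (hAbd N a b hab p Φ hΦ heq m hm (by omega) γ x i s).trans ?_
      gcongr
      exact le_max_left _ _

/-- The derivatives of `g ∘ X_T` for the flow `X`, uniformly in the driving path. -/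
theorem exists_abs_mixedPartial_comp_flow_le {fU fV : C(ℝ, ℝ)} {lam KV H : ℝ}
    (hf : ForceBounds fU fV lam KV H) (Kg : ℝ) :
    ∃ C : ℝ, 0 ≤ C ∧ ∀ (N : ℕ) (a b : ℝ) (hab : a ≤ b) (p : Fin N → C(Set.Icc a b, ℝ))
      (Φ : (Fin N → ℝ) → Fin N → C(Set.Icc a b, ℝ)), ContDiff ℝ 6 Φ →
      (∀ x i, Φ x i = p i + ContinuousMap.const _ (x i) + volterra hab (driftOp fU fV (Φ x) i)) →
      ∀ g : (Fin N → ℝ) → ℝ, ContDiff ℝ 6 g →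
      (∀ n, 1 ≤ n → n ≤ 6 → ∀ (γ : Fin n → Fin N) x,
        |mixedPartial γ g x| ≤ Kg * sepWeight (Finset.univ.image γ) ∅) →
      ∀ n, 1 ≤ n → n ≤ 6 → ∀ (γ : Fin n → Fin N) x s,
        |mixedPartial γ (fun y => g fun i => Φ y i s) x| ≤
          C * Real.exp (-(lam / 2) * (s - a)) * sepWeight (Finset.univ.image γ) ∅ := by
  obtain ⟨A, hA, hAbd⟩ := exists_abs_mixedPartial_flow_le hf le_rfl
  have hlam := hf.lam_pos
  -- There are at most six blocks, each contributing a factor `A`; the last power is the bound of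
  -- `sum_sepWeight_image_le` with at most six values of `γ` and at most six free indices.
  set B : ℝ := |Kg| * A ^ 6 * (1 + 6 + 6) ^ 6 with hB
  have hB0 : 0 ≤ B := by positivity
  refine ⟨∑ n ∈ Finset.range 7, Fintype.card (OrderedFinpartition n) * B, by positivity, ?_⟩
  intro N a b hab p Φ hΦ heq g hg hgb n hn hn6 γ x s
  have h6 : ((n : ℕ) : WithTop ℕ∞) ≤ 6 := by exact_mod_cast hn6
  have hΦs : ContDiff ℝ n (fun y i => Φ y i s) := contDiff_pi.2 fun i =>
    contDiff_path_apply (hΦ.of_le h6) i s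
  rw [mixedPartial_comp_pi γ (hg.of_le h6) hΦs]
  set θ := Real.exp (-(lam / 2) * (s - a)) with hθ
  have hθ0 : 0 ≤ θ := (Real.exp_pos _).le
  have hθ1 : θ ≤ 1 := Real.exp_le_one_iff.2
    (mul_nonpos_of_nonpos_of_nonneg (by linarith) (by linarith [s.2.1]))
  set S := Finset.univ.image γ with hS
  have hScard : S.card ≤ 6 := Finset.card_image_le.trans (by simpa using hn6)
  have hS0 := sepWeight_nonneg S ∅
  have hterm : ∀ c : OrderedFinpartition n, |∑ r : Fin c.length → Fin N,
      (∏ m, mixedPartial (γ ∘ c.emb m) (fun y => Φ y (r m) s) x) *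
        mixedPartial r g (fun i => Φ x i s)| ≤ B * θ * sepWeight S ∅ := by
    intro c
    have hlen : 1 ≤ c.length := c.length_pos hn
    have hlen6 : c.length ≤ 6 := c.length_le.trans hn6
    have hr : ∀ r : Fin c.length → Fin N,
        |(∏ m, mixedPartial (γ ∘ c.emb m) (fun y => Φ y (r m) s) x) *
          mixedPartial r g (fun i => Φ x i s)| ≤
        |Kg| * A ^ 6 * θ * sepWeight S ∅ * sepWeight (Finset.univ.image r) S := by
      intro r
      rw [abs_mul, Finset.abs_prod]
      have h1 : ∏ m, |mixedPartial (γ ∘ c.emb m) (fun y => Φ y (r m) s) x| ≤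
          A ^ 6 * θ * ∏ m, sepWeight (Finset.univ.image (γ ∘ c.emb m)) {r m} := by
        calc _ ≤ ∏ m, (A * θ * sepWeight (Finset.univ.image (γ ∘ c.emb m)) {r m}) :=
              Finset.prod_le_prod (fun _ _ => abs_nonneg _) fun m _ =>
                hAbd N a b hab p Φ hΦ heq _ (c.partSize_pos m) ((c.partSize_le m).trans hn6) _ x _ s
          _ = (A ^ c.length * θ ^ c.length) *
              ∏ m, sepWeight (Finset.univ.image (γ ∘ c.emb m)) {r m} := by
              rw [Finset.prod_mul_distrib]; simp [mul_pow]
          _ ≤ _ := by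
              refine mul_le_mul_of_nonneg_right ?_
                (Finset.prod_nonneg fun _ _ => sepWeight_nonneg _ _)
              refine mul_le_mul (pow_le_pow_right₀ hA hlen6) ?_ (by positivity) (by positivity)
              exact pow_le_of_le_one hθ0 hθ1 (by omega)
      have h2 : |mixedPartial r g (fun i => Φ x i s)| ≤
          |Kg| * sepWeight (Finset.univ.image r) ∅ :=
        (hgb _ hlen hlen6 r _).trans
          (mul_le_mul_of_nonneg_right (le_abs_self _) (sepWeight_nonneg _ _))
      have h3 := sepWeight_mul_prod_le γ c r
      calc _ ≤ (A ^ 6 * θ * ∏ m, sepWeight (Finset.univ.image (γ ∘ c.emb m)) {r m}) *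
            (|Kg| * sepWeight (Finset.univ.image r) ∅) :=
            mul_le_mul h1 h2 (abs_nonneg _) (mul_nonneg (by positivity)
              (Finset.prod_nonneg fun _ _ => sepWeight_nonneg _ _))
        _ = |Kg| * A ^ 6 * θ * (sepWeight (Finset.univ.image r) ∅ *
            ∏ m, sepWeight (Finset.univ.image (γ ∘ c.emb m)) {r m}) := by ring
        _ ≤ |Kg| * A ^ 6 * θ * (sepWeight S ∅ * sepWeight (Finset.univ.image r) S) :=
            mul_le_mul_of_nonneg_left h3 (by positivity)
        _ = _ := by ring
    calc _ ≤ ∑ r : Fin c.length → Fin N,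
          |Kg| * A ^ 6 * θ * sepWeight S ∅ * sepWeight (Finset.univ.image r) S :=
          (Finset.abs_sum_le_sum_abs _ _).trans (Finset.sum_le_sum fun r _ => hr r)
      _ ≤ |Kg| * A ^ 6 * θ * sepWeight S ∅ * (1 + 6 + 6) ^ 6 := by
          rw [← Finset.mul_sum]
          refine mul_le_mul_of_nonneg_left ?_ (by positivity)
          refine (sum_sepWeight_image_le S hScard c.length).trans ?_
          have hl : (c.length : ℝ) ≤ 6 := by exact_mod_cast hlen6
          push_cast
          calc (1 + 6 + (c.length : ℝ)) ^ c.length ≤ (1 + 6 + 6) ^ c.length := by gcongr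
            _ ≤ _ := pow_le_pow_right₀ (by norm_num) hlen6
      _ = _ := by rw [hB]; ring
  refine (Finset.abs_sum_le_sum_abs _ _).trans ((Finset.sum_le_sum fun c _ => hterm c).trans ?_)
  rw [Finset.sum_const, nsmul_eq_mul, Finset.card_univ]
  have h7 : (Fintype.card (OrderedFinpartition n) : ℝ) * B ≤
      ∑ n ∈ Finset.range 7, Fintype.card (OrderedFinpartition n) * B :=
    Finset.single_le_sum (f := fun n => (Fintype.card (OrderedFinpartition n) : ℝ) * B)
      (fun _ _ => by positivity) (Finset.mem_range.2 (by omega))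
  calc _ = (Fintype.card (OrderedFinpartition n) : ℝ) * B * θ * sepWeight S ∅ := by ring
    _ ≤ _ := by gcongr

end FlowDerivatives

/-! ### Differentiation under the expectation -/

section ParametricIntegral

variable {Ω : Type*} [MeasurableSpace Ω] {P : Measure Ω} {N : ℕ}

/-- Directional derivatives are limits of measurable difference quotients, and in finite dimension
they determine the full derivative. -/
lemma aestronglyMeasurable_fderiv_param {F : Type*} [NormedAddCommGroup F] [NormedSpace ℝ F]
    {H : Ω → (Fin N → ℝ) → F} (hH : ∀ ω, Differentiable ℝ (H ω))
    (hm : ∀ x, AEStronglyMeasurable (fun ω => H ω x) P) (x : Fin N → ℝ) :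
    AEStronglyMeasurable (fun ω => fderiv ℝ (H ω) x) P := by
  have hdir : ∀ e : Fin N → ℝ, AEStronglyMeasurable (fun ω => fderiv ℝ (H ω) x e) P := by
    intro e
    refine aestronglyMeasurable_of_tendsto_ae Filter.atTop
      (f := fun (n : ℕ) ω => ((n : ℝ) + 1) • (H ω (x + ((n : ℝ) + 1)⁻¹ • e) - H ω x))
      (fun n => ((hm _).sub (hm _)).const_smul _) (Filter.Eventually.of_forall fun ω => ?_)
    have h1 : Filter.Tendsto (fun n : ℕ => ‖(n : ℝ) + 1‖) Filter.atTop Filter.atTop :=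
      tendsto_norm_atTop_atTop.comp
        (Filter.tendsto_atTop_add_const_right _ _ tendsto_natCast_atTop_atTop)
    have h2 := (hH ω x).hasFDerivAt.lim e (c := fun n : ℕ => (n : ℝ) + 1) h1
    exact h2
  have hsum : ∀ ω, fderiv ℝ (H ω) x = ∑ i : Fin N,
      (ContinuousLinearMap.proj (R := ℝ) (φ := fun _ : Fin N => ℝ) i).smulRight
        (fderiv ℝ (H ω) x (Pi.single i 1)) := by
    intro ω
    refine ContinuousLinearMap.ext fun v => ?_
    conv_lhs => rw [← Finset.univ_sum_single v]
    simp only [map_sum, sum_apply, ContinuousLinearMap.smulRight_apply,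
      ContinuousLinearMap.proj_apply]
    refine Finset.sum_congr rfl fun i _ => ?_
    have : (Pi.single i (v i) : Fin N → ℝ) = v i • Pi.single i 1 := by
      rw [← Pi.single_smul, smul_eq_mul, mul_one]
    rw [this, map_smul]
  rw [funext hsum]
  refine Finset.aestronglyMeasurable_fun_sum _ fun i _ => ?_
  exact (ContinuousLinearMap.smulRightL ℝ (Fin N → ℝ) F
    (ContinuousLinearMap.proj (R := ℝ) (φ := fun _ : Fin N => ℝ) i)).continuous.comp_aestronglyMeasurable
      (hdir _)

lemma hasFDerivAt_integral_of_bounded_fderiv {F : Type*} [NormedAddCommGroup F] [NormedSpace ℝ F]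
    [IsFiniteMeasure P]
    {H : Ω → (Fin N → ℝ) → F} (hH : ∀ ω, Differentiable ℝ (H ω))
    (hi : ∀ x, Integrable (fun ω => H ω x) P) {C : ℝ} (hC : ∀ ω x, ‖fderiv ℝ (H ω) x‖ ≤ C)
    (x : Fin N → ℝ) :
    HasFDerivAt (fun y => ∫ ω, H ω y ∂P) (∫ ω, fderiv ℝ (H ω) x ∂P) x :=
  hasFDerivAt_integral_of_dominated_of_fderiv_le (bound := fun _ => C) Filter.univ_mem
    (Filter.Eventually.of_forall fun y => (hi y).1) (hi x)
    (aestronglyMeasurable_fderiv_param hH (fun y => (hi y).1) x)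
    (Filter.Eventually.of_forall fun ω y _ => hC ω y) (integrable_const C)
    (Filter.Eventually.of_forall fun ω y _ => (hH ω y).hasFDerivAt)

/-- The target `F` is general because the induction passes from `H` to its derivative, which takes
values in a space of linear maps. -/
lemma contDiff_integral_of_bounded [IsFiniteMeasure P] (n : ℕ) :
    ∀ {F : Type} [NormedAddCommGroup F] [NormedSpace ℝ F] [CompleteSpace F]
    {H : Ω → (Fin N → ℝ) → F}, (∀ ω, ContDiff ℝ n (H ω)) →
    (∀ x, AEStronglyMeasurable (fun ω => H ω x) P) →
    ∀ C : ℕ → ℝ, (∀ k ≤ n, ∀ ω x, ‖iteratedFDeriv ℝ k (H ω) x‖ ≤ C k) →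
    ContDiff ℝ n (fun x => ∫ ω, H ω x ∂P) ∧
      ∀ x m, Integrable (fun ω => iteratedFDeriv ℝ n (H ω) x m) P ∧
        iteratedFDeriv ℝ n (fun x => ∫ ω, H ω x ∂P) x m =
          ∫ ω, iteratedFDeriv ℝ n (H ω) x m ∂P := by
  induction n with
  | zero =>
    intro F _ _ _ H hH hm C hC
    have hb : ∀ ω x, ‖H ω x‖ ≤ C 0 := fun ω x => by
      simpa using hC 0 le_rfl ω x
    refine ⟨contDiff_zero.2 ?_, fun x m => ⟨?_, ?_⟩⟩
    · exact continuous_of_dominated hm (fun x => Filter.Eventually.of_forall fun ω => hb ω x)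
        (integrable_const (C 0)) (Filter.Eventually.of_forall fun ω => (hH ω).continuous)
    · simpa using Integrable.of_bound (hm x) (C 0) (Filter.Eventually.of_forall fun ω => hb ω x)
    · simp
  | succ n ih =>
    intro F _ _ _ H hH hm C hC
    have hd : ∀ ω, Differentiable ℝ (H ω) := fun ω => (hH ω).differentiable (by simp)
    have hb : ∀ ω x, ‖H ω x‖ ≤ C 0 := fun ω x => by
      simpa using hC 0 (by omega) ω x
    have hi : ∀ x, Integrable (fun ω => H ω x) P := fun x =>
      Integrable.of_bound (hm x) (C 0) (Filter.Eventually.of_forall fun ω => hb ω x)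
    have hb1 : ∀ ω x, ‖fderiv ℝ (H ω) x‖ ≤ C 1 := fun ω x => by
      rw [← norm_iteratedFDeriv_one]; exact hC 1 (by omega) ω x
    have hder : ∀ x, HasFDerivAt (fun y => ∫ ω, H ω y ∂P) (∫ ω, fderiv ℝ (H ω) x ∂P) x :=
      hasFDerivAt_integral_of_bounded_fderiv hd hi hb1
    have hfd : fderiv ℝ (fun y => ∫ ω, H ω y ∂P) = fun x => ∫ ω, fderiv ℝ (H ω) x ∂P :=
      funext fun x => (hder x).fderiv
    obtain ⟨h1, h2⟩ := ih (H := fun ω => fderiv ℝ (H ω))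
      (fun ω => (hH ω).fderiv_right (by simp))
      (aestronglyMeasurable_fderiv_param hd hm) (fun k => C (k + 1))
      (fun k hk ω x => by rw [norm_iteratedFDeriv_fderiv]; exact hC _ (by omega) ω x)
    refine ⟨?_, fun x m => ⟨?_, ?_⟩⟩
    · have : ContDiff ℝ ((n : WithTop ℕ∞) + 1) (fun x => ∫ ω, H ω x ∂P) :=
        contDiff_succ_iff_hasFDerivAt.2 ⟨_, h1, hder⟩
      exact_mod_cast this
    · simp_rw [iteratedFDeriv_succ_apply_right]
      exact (ContinuousLinearMap.apply ℝ F (m (Fin.last n))).integrable_comp (h2 x (Fin.init m)).1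
    · simp_rw [iteratedFDeriv_succ_apply_right]
      rw [hfd, (h2 x (Fin.init m)).2, ContinuousLinearMap.integral_apply (h2 x (Fin.init m)).1]

/-- The integrand itself need only be integrable, as for an unbounded Lipschitz `g`. One
differentiation is done by hand; the derivative is bounded and falls under
`contDiff_integral_of_bounded`. -/
lemma contDiff_integral_of_bounded_derivatives [IsFiniteMeasure P] (n : ℕ)
    {H : Ω → (Fin N → ℝ) → ℝ} (hH : ∀ ω, ContDiff ℝ (n + 1 : ℕ) (H ω))
    (hi : ∀ x, Integrable (fun ω => H ω x) P) (C : ℕ → ℝ)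
    (hC : ∀ k, 1 ≤ k → k ≤ n + 1 → ∀ ω x, ‖iteratedFDeriv ℝ k (H ω) x‖ ≤ C k) :
    ContDiff ℝ (n + 1 : ℕ) (fun x => ∫ ω, H ω x ∂P) ∧
      ∀ k, 1 ≤ k → k ≤ n + 1 → ∀ x m,
        iteratedFDeriv ℝ k (fun x => ∫ ω, H ω x ∂P) x m =
          ∫ ω, iteratedFDeriv ℝ k (H ω) x m ∂P := by
  have hd : ∀ ω, Differentiable ℝ (H ω) := fun ω => (hH ω).differentiable (by simp)
  have hb1 : ∀ ω x, ‖fderiv ℝ (H ω) x‖ ≤ C 1 := fun ω x => by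
    rw [← norm_iteratedFDeriv_one]; exact hC 1 le_rfl (by omega) ω x
  have hder : ∀ x, HasFDerivAt (fun y => ∫ ω, H ω y ∂P) (∫ ω, fderiv ℝ (H ω) x ∂P) x :=
    hasFDerivAt_integral_of_bounded_fderiv hd hi hb1
  have hfd : fderiv ℝ (fun y => ∫ ω, H ω y ∂P) = fun x => ∫ ω, fderiv ℝ (H ω) x ∂P :=
    funext fun x => (hder x).fderiv
  have key : ∀ k ≤ n, _ := fun k (hk : k ≤ n) =>
    contDiff_integral_of_bounded (P := P) k (H := fun ω => fderiv ℝ (H ω))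
      (fun ω => (hH ω).fderiv_right (by exact_mod_cast (by omega : k + 1 ≤ n + 1)))
      (aestronglyMeasurable_fderiv_param hd fun x => (hi x).1) (fun k => C (k + 1))
      (fun l hl ω x => by
        rw [norm_iteratedFDeriv_fderiv]; exact hC _ (by omega) (by omega) ω x)
  refine ⟨?_, ?_⟩
  · have : ContDiff ℝ ((n : WithTop ℕ∞) + 1) (fun x => ∫ ω, H ω x ∂P) :=
      contDiff_succ_iff_hasFDerivAt.2 ⟨_, (key n le_rfl).1, hder⟩
    exact_mod_cast this
  · intro k hk hkn x m
    obtain ⟨l, rfl⟩ : ∃ l, k = l + 1 := ⟨k - 1, by omega⟩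
    have h2 := (key l (by omega)).2
    simp_rw [iteratedFDeriv_succ_apply_right]
    rw [hfd, (h2 x (Fin.init m)).2, ContinuousLinearMap.integral_apply (h2 x (Fin.init m)).1]

end ParametricIntegral

lemma norm_iteratedFDeriv_le_sum_mixedPartial {N : ℕ} (n : ℕ) (f : (Fin N → ℝ) → ℝ)
    (x : Fin N → ℝ) :
    ‖iteratedFDeriv ℝ n f x‖ ≤ ∑ γ : Fin n → Fin N, |mixedPartial γ f x| := by
  refine ContinuousMultilinearMap.opNorm_le_bound
    (Finset.sum_nonneg fun _ _ => abs_nonneg _) fun v => ?_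
  have hv : v = fun k => ∑ i : Fin N, v k i • (Pi.single i (1 : ℝ) : Fin N → ℝ) := by
    funext k
    conv_lhs => rw [← Finset.univ_sum_single (v k)]
    refine Finset.sum_congr rfl fun i _ => ?_
    rw [← Pi.single_smul, smul_eq_mul, mul_one]
  conv_lhs => rw [hv]
  rw [ContinuousMultilinearMap.map_sum, Finset.sum_mul]
  refine (norm_sum_le _ _).trans (Finset.sum_le_sum fun γ _ => ?_)
  rw [ContinuousMultilinearMap.map_smul_univ, norm_smul, mul_comm]
  refine mul_le_mul_of_nonneg_left ?_ (abs_nonneg _)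
  rw [norm_prod]
  exact Finset.prod_le_prod (fun _ _ => norm_nonneg _) fun k _ => norm_le_pi_norm (v k) (γ k)

/-! ### Grönwall's inequality and integrability of the dominating function -/

section Growth

/-- Grönwall's inequality for a non-monotone `f`: the function `∫ f - e^{-l(s-a)} ∫ y` is
nondecreasing and vanishes at `a`. -/
lemma le_of_le_add_integral {y f : ℝ → ℝ} (hy : Continuous y) (hf : Continuous f)
    {a b l : ℝ} (hab : a ≤ b) (hl : 0 ≤ l) (hf0 : ∀ s, 0 ≤ f s)
    (h : ∀ s ∈ Set.Icc a b, y s ≤ f s + l * ∫ r in a..s, y r) :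
    y b ≤ f b + l * (Real.exp (l * (b - a)) * ∫ r in a..b, f r) := by
  set A : ℝ → ℝ := fun s => ∫ r in a..s, y r with hA
  have hAd : ∀ s, HasDerivAt A (y s) s := fun s => (hy.integral_hasStrictDerivAt a s).hasDerivAt
  have hFd : ∀ s, HasDerivAt (fun s => ∫ r in a..s, f r) (f s) s := fun s =>
    (hf.integral_hasStrictDerivAt a s).hasDerivAt
  set D : ℝ → ℝ := fun s => (∫ r in a..s, f r) - Real.exp (-(l * (s - a))) * A s with hD
  have hDd : ∀ s, HasDerivAt D
      (f s - (Real.exp (-(l * (s - a))) * (-l) * A s + Real.exp (-(l * (s - a))) * y s)) s := by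
    intro s
    have he : HasDerivAt (fun s => Real.exp (-(l * (s - a))))
        (Real.exp (-(l * (s - a))) * (-l)) s := by
      have := ((((hasDerivAt_id' s).sub_const a).const_mul l).fun_neg).exp
      simpa using this
    exact (hFd s).fun_sub (he.mul (hAd s))
  have hmono : MonotoneOn D (Set.Icc a b) := by
    refine monotoneOn_of_hasDerivWithinAt_nonneg (convex_Icc a b)
      (fun s _ => (hDd s).continuousAt.continuousWithinAt)
      (fun s _ => (hDd s).hasDerivWithinAt) fun s hs => ?_
    have hs' := interior_subset hs
    have h1 := h s hs'
    set e := Real.exp (-(l * (s - a))) with he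
    have he0 : 0 ≤ e := (Real.exp_pos _).le
    have he1 : e ≤ 1 := Real.exp_le_one_iff.2 (by
      have := mul_nonneg hl (sub_nonneg.2 hs'.1); linarith)
    have h2 : e * (y s - l * A s) ≤ e * f s := mul_le_mul_of_nonneg_left (by linarith) he0
    have h3 : e * f s ≤ f s := mul_le_of_le_one_left (hf0 s) he1
    linarith
  have h1 := hmono (Set.left_mem_Icc.2 hab) (Set.right_mem_Icc.2 hab) hab
  have h2 : D a = 0 := by simp [hD, hA]
  rw [h2] at h1
  have h3 : A b ≤ Real.exp (l * (b - a)) * ∫ r in a..b, f r := by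
    have h4 : Real.exp (-(l * (b - a))) * A b ≤ ∫ r in a..b, f r := by
      simp only [hD] at h1; linarith
    have h5 := mul_le_mul_of_nonneg_left h4 (Real.exp_pos (l * (b - a))).le
    rwa [← mul_assoc, ← Real.exp_add, add_neg_cancel, Real.exp_zero, one_mul] at h5
  exact (h b (Set.right_mem_Icc.2 hab)).trans
    (add_le_add le_rfl (mul_le_mul_of_nonneg_left h3 hl))

lemma norm_solution_le {a b : ℝ} (hab : a ≤ b) {N : ℕ} {fU fV : C(ℝ, ℝ)} {LU LV : ℝ≥0}
    (hU : LipschitzWith LU fU) (hV : LipschitzWith LV fV) {p Y : Fin N → C(Set.Icc a b, ℝ)}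
    (hY : ∀ i, Y i = p i + volterra hab (driftOp fU fV Y i)) {f : ℝ → ℝ} (hf : Continuous f)
    (hf0 : ∀ s, 0 ≤ f s)
    (hpf : ∀ i s, |p i s| + (|fU 0| + |fV 0|) * (b - a) ≤ f s) :
    ‖fun i => Y i ⟨b, Set.right_mem_Icc.2 hab⟩‖ ≤
      f b + (LU + 2 * LV) * (Real.exp ((LU + 2 * LV) * (b - a)) * ∫ r in a..b, f r) := by
  set y : ℝ → ℝ := fun s => ‖fun i => Y i (Set.projIcc a b hab s)‖ with hy
  have hyc : Continuous y := by
    refine Continuous.norm (continuous_pi fun i => ?_)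
    exact (Y i).continuous.comp continuous_projIcc
  have hend : Set.projIcc a b hab b = ⟨b, Set.right_mem_Icc.2 hab⟩ :=
    Set.projIcc_of_mem hab (Set.right_mem_Icc.2 hab)
  have key := le_of_le_add_integral hyc hf (l := LU + 2 * LV) hab (by positivity) hf0 ?_
  · simpa only [hy, hend] using key
  intro s hs
  have hyint : 0 ≤ ∫ r in a..s, y r :=
    intervalIntegral.integral_nonneg hs.1 fun r _ => norm_nonneg _
  simp only [hy, Set.projIcc_of_mem hab hs]
  refine (pi_norm_le_iff_of_nonneg
    (add_nonneg (hf0 s) (mul_nonneg (by positivity) hyint))).2 fun i => ?_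
  set d := |fU 0| + |fV 0| with hd
  have hdr : ∀ r : Set.Icc a b, |driftOp fU fV Y i r| ≤ d + (LU + 2 * LV) * ‖fun j => Y j r‖ := by
    intro r
    have h1 := abs_driftOp_sub_le hU hV Y (fun _ => 0) r i
    have h2 : |driftOp fU fV (fun _ : Fin N => (0 : C(Set.Icc a b, ℝ))) i r| ≤ d := by
      rw [driftOp_apply]
      simp only [ContinuousMap.zero_apply, sub_zero, Finset.sum_const, Finset.card_univ,
        Fintype.card_fin, nsmul_eq_mul]
      refine (abs_sub _ _).trans ?_
      rw [abs_neg]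
      refine add_le_add le_rfl ?_
      rw [← mul_assoc, abs_mul, abs_of_nonneg (by positivity)]
      refine mul_le_of_le_one_left (abs_nonneg _) ?_
      rw [mul_comm]; exact natCast_mul_inv_le_one N
    simp only [ContinuousMap.zero_apply, sub_zero] at h1
    have h3 := abs_add_le (driftOp fU fV Y i r - driftOp fU fV (fun _ => 0) i r)
      (driftOp fU fV (fun _ => 0) i r)
    rw [sub_add_cancel] at h3
    linarith
  have hvol : |volterra hab (driftOp fU fV Y i) ⟨s, hs⟩| ≤
      d * (b - a) + (LU + 2 * LV) * ∫ r in a..s, y r := by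
    rw [volterra_apply]
    have h1 : ‖∫ r in a..s, Set.IccExtend hab (driftOp fU fV Y i) r‖ ≤
        ∫ r in a..s, (d + (LU + 2 * LV) * y r) := by
      refine intervalIntegral.norm_integral_le_of_norm_le hs.1
        (Filter.Eventually.of_forall fun r hr => hdr _)
        (Continuous.intervalIntegrable (by fun_prop) _ _)
    rw [intervalIntegral.integral_add (by simp)
      ((hyc.const_mul _).intervalIntegrable _ _), intervalIntegral.integral_const,
      intervalIntegral.integral_const_mul, smul_eq_mul] at h1
    refine h1.trans (add_le_add ?_ le_rfl)
    rw [mul_comm]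
    exact mul_le_mul_of_nonneg_left (by linarith [hs.2]) (by positivity)
  have h4 : Y i ⟨s, hs⟩ = p i ⟨s, hs⟩ + volterra hab (driftOp fU fV Y i) ⟨s, hs⟩ :=
    DFunLike.congr_fun (hY i) ⟨s, hs⟩
  rw [Real.norm_eq_abs, h4]
  have h5 := hpf i ⟨s, hs⟩
  have h6 := abs_add_le (p i ⟨s, hs⟩) (volterra hab (driftOp fU fV Y i) ⟨s, hs⟩)
  linarith

end Growth

section Integrability

variable {Ω : Type*} [mΩ : MeasurableSpace Ω] {P : Measure Ω}

lemma integrable_intervalIntegral_of_continuous [IsFiniteMeasure P] {h : ℝ → Ω → ℝ} {a b M : ℝ}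
    (hab : a ≤ b) (hm : ∀ s, Measurable (h s)) (hc : ∀ᵐ ω ∂P, Continuous fun s => h s ω)
    (hi : ∀ s, Integrable (h s) P) (hM : ∀ s ∈ Set.Ioc a b, ∫ ω, ‖h s ω‖ ∂P ≤ M) :
    Integrable (fun ω => ∫ s in a..b, h s ω) P := by
  -- Paths are continuous only almost surely. Setting them to zero on a measurable null set gives
  -- joint measurability, and then Fubini applies.
  obtain ⟨A, hA, hAm, hA0⟩ := exists_measurable_superset_of_null (ae_iff.1 hc)
  set u : ℝ → Ω → ℝ := fun s => Set.indicator Aᶜ (h s) with hu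
  have hum : ∀ s, Measurable (u s) := fun s => (hm s).indicator hAm.compl
  have huc : ∀ ω, Continuous fun s => u s ω := by
    intro ω
    by_cases hω : ω ∈ A
    · have : (fun s => u s ω) = fun _ => 0 := funext fun s => by simp [hu, hω]
      rw [this]; exact continuous_const
    · have : (fun s => u s ω) = fun s => h s ω := funext fun s => by simp [hu, hω]
      rw [this]
      by_contra hcon
      exact hω (hA hcon)
  have hunc : Measurable (Function.uncurry u) :=
    measurable_uncurry_of_continuous_of_measurable huc hum
  have hAae : ∀ᵐ ω ∂P, ω ∉ A := measure_eq_zero_iff_ae_notMem.1 hA0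
  have hae : ∀ s, u s =ᵐ[P] h s := fun s => by
    filter_upwards [hAae] with ω hω
    simp [hu, hω]
  have hprod : Integrable (Function.uncurry u) ((volume.restrict (Set.Ioc a b)).prod P) := by
    rw [integrable_prod_iff hunc.aestronglyMeasurable]
    refine ⟨Filter.Eventually.of_forall fun s => (hi s).congr (hae s).symm, ?_⟩
    refine Integrable.of_bound (C := M) ?_ ?_
    · exact (StronglyMeasurable.integral_prod_right
        (f := fun s ω => ‖u s ω‖) hunc.norm.stronglyMeasurable).aestronglyMeasurable
    · refine (ae_restrict_iff' measurableSet_Ioc).2 (Filter.Eventually.of_forall fun s hs => ?_)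
      rw [Real.norm_of_nonneg (integral_nonneg fun _ => norm_nonneg _)]
      refine le_trans (le_of_eq (integral_congr_ae ?_)) (hM s hs)
      filter_upwards [hae s] with ω hω
      simp [hω]
  refine hprod.integral_prod_right.congr ?_
  filter_upwards [hAae] with ω hω
  rw [intervalIntegral.integral_of_le hab]
  simp [hu, hω]

lemma integral_abs_brownian_le [IsProbabilityMeasure P] {B : ℝ≥0 → Ω → ℝ}
    (hB : IsPreBrownianReal B P) (s : ℝ≥0) : ∫ ω, |B s ω| ∂P ≤ 1 + s := by
  have h2 : MemLp (B s) 2 P := (hB.isGaussianProcess.hasGaussianLaw_eval s).memLp_two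
  have hvar : ∫ ω, B s ω ^ 2 ∂P = s := by
    rw [← variance_of_integral_eq_zero (hB.aemeasurable s) (hB.integral_eval s),
      ← covariance_self (hB.aemeasurable s), hB.covariance_eval, min_self]
  calc ∫ ω, |B s ω| ∂P ≤ ∫ ω, (1 + B s ω ^ 2) ∂P := by
        refine integral_mono (hB.integrable_eval s).abs
          ((integrable_const _).add h2.integrable_sq) fun ω => ?_
        change |B s ω| ≤ 1 + B s ω ^ 2
        rw [← sq_abs]
        nlinarith [sq_nonneg (|B s ω| - 1)]
    _ = 1 + s := by
        rw [integral_add (integrable_const _) h2.integrable_sq, hvar]; simp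

end Integrability

/-! ### From the potentials to the bounds on the forces -/

section Potentials

/-- The convexity inequalities say that `U' - lam * x` and `V'` are monotone, which gives the signs
of the derivatives; `H` is the sum of all the bounds on higher derivatives. -/
lemma PotentialAssumptions.exists_forceBounds {U V : ℝ → ℝ} {lam KV : ℝ}
    (h : PotentialAssumptions U V lam KV) {fU fV : C(ℝ, ℝ)} (hU : ⇑fU = deriv U)
    (hV : ⇑fV = deriv V) : ∃ H, ForceBounds fU fV lam KV H := by
  have cU : ContDiff ℝ 6 fU := by
    rw [hU]
    exact (contDiff_succ_iff_deriv.1 (show ContDiff ℝ (6 + 1) U from h.contDiff_U)).2.2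
  have cV : ContDiff ℝ 6 fV := by
    rw [hV]
    exact (contDiff_succ_iff_deriv.1 (show ContDiff ℝ (6 + 1) V from h.contDiff_V)).2.2
  have hmono : ∀ {f : ℝ → ℝ}, (∀ x y, 0 ≤ (f x - f y) * (x - y)) → Monotone f := by
    intro f hf x y hxy
    rcases hxy.eq_or_lt with rfl | hlt
    · exact le_rfl
    · have := nonneg_of_mul_nonneg_left (hf y x) (sub_pos.2 hlt)
      linarith
  choose! bU hbU using h.bounded_U
  choose! bV hbV using h.bounded_V
  have hsum : ∀ k ≤ 6, |bU k| + |bV k| ≤ ∑ k ∈ Finset.range 7, (|bU k| + |bV k|) := fun k hk =>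
    Finset.single_le_sum (f := fun k => |bU k| + |bV k|) (fun _ _ => by positivity)
      (Finset.mem_range.2 (by omega))
  refine ⟨∑ k ∈ Finset.range 7, (|bU k| + |bV k|), cU, cV, h.lam_pos, h.KV_pos.le, ?_, ?_, ?_,
    by positivity, ?_, ?_⟩
  · intro y
    have hm : Monotone fun x => fU x - lam * x := hmono fun x y => by
      have := h.convex_U x y
      rw [sq_abs] at this
      rw [hU]
      nlinarith
    have h1 : deriv (fun x => fU x - lam * x) y = deriv fU y - lam := by
      have hd := (cU.differentiable (by norm_num) y).hasDerivAt
      simpa using (hd.fun_sub ((hasDerivAt_id' y).const_mul lam)).deriv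
    have := hm.deriv_nonneg (x := y)
    rw [h1] at this
    linarith
  · intro y
    rw [hV]
    exact (hmono h.convex_V).deriv_nonneg
  · intro y
    rw [hV]
    exact (le_abs_self _).trans (h.hessian_V y)
  · intro k hk hk6 y
    rw [hU]
    exact (hbU k (by omega) hk6 y).trans ((le_abs_self _).trans
      ((le_add_of_nonneg_right (abs_nonneg _)).trans (hsum k hk6)))
  · intro k hk hk6 y
    rw [hV]
    exact (hbV k (by omega) hk6 y).trans ((le_abs_self _).trans
      ((le_add_of_nonneg_left (abs_nonneg _)).trans (hsum k hk6)))

lemma TestFunctionAssumptions.exists_lipschitzWith {N : ℕ} {g : (Fin N → ℝ) → ℝ} {Kg : ℝ}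
    (hg : TestFunctionAssumptions g Kg) : ∃ L : ℝ≥0, LipschitzWith L g := by
  obtain ⟨L, hL⟩ := hg.lipschitz 0 (by omega)
  refine ⟨L, LipschitzWith.of_dist_le_mul fun x y => ?_⟩
  have := hL.dist_le_mul x y
  rwa [iteratedFDeriv_zero_eq_comp, Function.comp_apply, Function.comp_apply,
    LinearIsometryEquiv.dist_map] at this

end Potentials

/-! ### Pathwise form of the particle system -/

section PathwiseFlow

variable {Ω : Type*} {N : ℕ} {W : ℝ≥0 → Ω → Fin N → ℝ}

/-- The pathwise noise `σ (W_s - W_t)` on `[t, T]` (zero if the path is discontinuous). -/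
noncomputable def noisePath (W : ℝ≥0 → Ω → Fin N → ℝ) (σ : ℝ) (t T : ℝ≥0) (ω : Ω) (i : Fin N) :
    C(Set.Icc (t : ℝ) (T : ℝ), ℝ) :=
  open Classical in
  if h : Continuous fun s => W s ω i then
    ⟨fun s => σ * (W (s : ℝ).toNNReal ω i - W t ω i),
      continuous_const.mul ((h.comp (continuous_real_toNNReal.comp continuous_subtype_val)).sub
        continuous_const)⟩
  else 0

lemma noisePath_apply {σ : ℝ} {t T : ℝ≥0} {ω : Ω} {i : Fin N}
    (h : Continuous fun s => W s ω i) (s : Set.Icc (t : ℝ) (T : ℝ)) :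
    noisePath W σ t T ω i s = σ * (W (s : ℝ).toNNReal ω i - W t ω i) := by
  simp [noisePath, h]

variable [mΩ : MeasurableSpace Ω] {P : Measure Ω} {ℱ : Filtration ℝ≥0 mΩ}

lemma IsBrownianMotion.measurable_apply (hW : IsBrownianMotion P ℱ W) (s : ℝ≥0) (i : Fin N) :
    Measurable fun ω => W s ω i :=
  (measurable_pi_apply i).comp ((hW.adapted s).mono (ℱ.le s) le_rfl)

lemma IsBrownianMotion.ae_continuous (hW : IsBrownianMotion P ℱ W) :
    ∀ᵐ ω ∂P, ∀ i, Continuous fun s => W s ω i :=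
  ae_all_iff.2 fun i => (hW.brownian i).cont

lemma IsParticleSolution.ae_eq_integral_equation {U V : ℝ → ℝ} {σ : ℝ} {t T : ℝ≥0} (htT : t ≤ T)
    {x : Fin N → ℝ} {Y : ℝ≥0 → Ω → Fin N → ℝ} (hW : IsBrownianMotion P ℱ W)
    (hY : IsParticleSolution P ℱ U V σ W t x Y) {fU fV : C(ℝ, ℝ)} (hU : ⇑fU = deriv U)
    (hV : ⇑fV = deriv V) :
    ∀ᵐ ω ∂P, ∃ Z : Fin N → C(Set.Icc (t : ℝ) (T : ℝ), ℝ),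
      (∀ i, Z i = (noisePath W σ t T ω i + ContinuousMap.const _ (x i)) +
        volterra (NNReal.coe_le_coe.2 htT) (driftOp fU fV Z i)) ∧
      ∀ i s, Z i s = Y (s : ℝ).toNNReal ω i := by
  have hab : (t : ℝ) ≤ T := NNReal.coe_le_coe.2 htT
  filter_upwards [hW.ae_continuous, hY.continuous, hY.equation] with ω hWc hYc hYe
  have hle : ∀ s : Set.Icc (t : ℝ) (T : ℝ), t ≤ (s : ℝ).toNNReal := fun s =>
    NNReal.le_toNNReal_of_coe_le s.2.1
  have hcoe : ∀ s : Set.Icc (t : ℝ) (T : ℝ), ((s : ℝ).toNNReal : ℝ) = s := fun s =>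
    Real.coe_toNNReal _ (t.2.trans s.2.1)
  have hc : ∀ i, Continuous fun s : Set.Icc (t : ℝ) (T : ℝ) => Y (s : ℝ).toNNReal ω i := fun i =>
    (continuous_apply i).comp
      (hYc.comp_continuous (continuous_real_toNNReal.comp continuous_subtype_val) hle)
  refine ⟨fun i => ⟨_, hc i⟩, fun i => ?_, fun i s => rfl⟩
  ext s
  simp only [ContinuousMap.add_apply, ContinuousMap.coe_mk, ContinuousMap.const_apply,
    noisePath_apply (hWc i), volterra_apply]
  rw [hYe _ (hle s) i, hcoe]
  have hint : ∫ r in (t : ℝ)..(s : ℝ), drift U V (Y r.toNNReal ω) i =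
      ∫ r in (t : ℝ)..(s : ℝ), Set.IccExtend hab
        (driftOp fU fV (fun i => (⟨_, hc i⟩ : C(Set.Icc (t : ℝ) (T : ℝ), ℝ))) i) r := by
    refine intervalIntegral.integral_congr fun r hr => ?_
    rw [Set.uIcc_of_le s.2.1] at hr
    have hr' : r ∈ Set.Icc (t : ℝ) (T : ℝ) := ⟨hr.1, hr.2.trans s.2.2⟩
    simp only [Set.IccExtend_of_mem hab _ hr', driftOp_apply, hU, hV, drift, one_div,
      ContinuousMap.coe_mk]
  rw [hint]
  ring

/-- These are the two random terms of the Grönwall bound for the flow, used to dominate `g(X_T)`. -/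
lemma IsBrownianMotion.integrable_running_noise [IsProbabilityMeasure P]
    (hW : IsBrownianMotion P ℱ W) (c σ : ℝ) {t T : ℝ≥0} (htT : t ≤ T) :
    (∀ s : ℝ≥0, Integrable (fun ω => c + |σ| * ∑ i, |W s ω i - W t ω i|) P) ∧
    Integrable (fun ω => ∫ s in (t : ℝ)..(T : ℝ),
      (c + |σ| * ∑ i, |W s.toNNReal ω i - W t ω i|)) P := by
  have hWi : ∀ (s : ℝ≥0) (i : Fin N), Integrable (fun ω => W s ω i) P := fun s i =>
    (hW.brownian i).integrable_eval s
  have habs : ∀ (s : ℝ≥0) (i : Fin N), Integrable (fun ω => |W s ω i - W t ω i|) P := fun s i =>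
    ((hWi s i).sub (hWi t i)).abs
  have hi : ∀ s : ℝ≥0, Integrable (fun ω => c + |σ| * ∑ i, |W s ω i - W t ω i|) P := fun s =>
    (integrable_const c).add ((integrable_finsetSum _ fun i _ => habs s i).const_mul _)
  refine ⟨hi, ?_⟩
  refine integrable_intervalIntegral_of_continuous
    (M := |c| + |σ| * ∑ _i : Fin N, ((1 + (T : ℝ)) + (1 + T))) (NNReal.coe_le_coe.2 htT) ?_ ?_
    (fun s => hi _) ?_
  · intro s
    have := fun i => hW.measurable_apply s.toNNReal i
    have := fun i => hW.measurable_apply t i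
    fun_prop
  · filter_upwards [hW.ae_continuous] with ω hω
    have : ∀ i, Continuous fun s : ℝ => W s.toNNReal ω i := fun i =>
      (hω i).comp continuous_real_toNNReal
    fun_prop
  · intro s hs
    have hsT : (s.toNNReal : ℝ) ≤ T := by
      rw [Real.coe_toNNReal _ (t.2.trans hs.1.le)]; exact hs.2
    have htT' : (t : ℝ) ≤ T := NNReal.coe_le_coe.2 htT
    have hbd : ∀ i, ∫ ω, |W s.toNNReal ω i - W t ω i| ∂P ≤ (1 + T) + (1 + T) := by
      intro i
      calc _ ≤ ∫ ω, (|W s.toNNReal ω i| + |W t ω i|) ∂P :=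
            integral_mono (habs _ i) ((hWi _ i).abs.add (hWi t i).abs) fun ω => abs_sub _ _
        _ = ∫ ω, |W s.toNNReal ω i| ∂P + ∫ ω, |W t ω i| ∂P :=
            integral_add (hWi _ i).abs (hWi t i).abs
        _ ≤ _ := by
            have h1 := integral_abs_brownian_le (hW.brownian i).toIsPreBrownianReal s.toNNReal
            have h2 := integral_abs_brownian_le (hW.brownian i).toIsPreBrownianReal t
            linarith
    calc _ ≤ ∫ ω, (|c| + |σ| * ∑ i, |W s.toNNReal ω i - W t ω i|) ∂P := by
          refine integral_mono (hi _).norm ((integrable_const _).add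
            ((integrable_finsetSum _ fun i _ => habs _ i).const_mul _)) fun ω => ?_
          refine (norm_add_le _ _).trans (add_le_add le_rfl (le_of_eq ?_))
          exact Real.norm_of_nonneg (by positivity)
      _ = |c| + |σ| * ∑ i, ∫ ω, |W s.toNNReal ω i - W t ω i| ∂P := by
          rw [integral_add (integrable_const _)
            ((integrable_finsetSum _ fun i _ => habs _ i).const_mul _), integral_const_mul,
            integral_finsetSum _ fun i _ => habs _ i]
          simp
      _ ≤ _ := by
          exact add_le_add le_rfl (mul_le_mul_of_nonneg_left
            (Finset.sum_le_sum fun i _ => hbd i) (abs_nonneg σ))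

end PathwiseFlow

/-! ### Derivatives of the Kolmogorov solution and the moment bounds -/

/-- The flow estimate enters as the hypothesis `hC`, so that `C` is chosen before `N`, `g` and the
probability space. -/
lemma contDiff_kolmogorovSolution_and_abs_mixedPartial_le {U V : ℝ → ℝ} {lam KV σ Kg C H : ℝ}
    (hUV : PotentialAssumptions U V lam KV) {fU fV : C(ℝ, ℝ)} (hU : ⇑fU = deriv U)
    (hV : ⇑fV = deriv V) (hF : ForceBounds fU fV lam KV H)
    (hC : ∀ (N : ℕ) (a b : ℝ) (hab : a ≤ b) (p : Fin N → C(Set.Icc a b, ℝ))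
      (Φ : (Fin N → ℝ) → Fin N → C(Set.Icc a b, ℝ)), ContDiff ℝ 6 Φ →
      (∀ x i, Φ x i = p i + ContinuousMap.const _ (x i) + volterra hab (driftOp fU fV (Φ x) i)) →
      ∀ g : (Fin N → ℝ) → ℝ, ContDiff ℝ 6 g →
      (∀ n, 1 ≤ n → n ≤ 6 → ∀ (γ : Fin n → Fin N) x,
        |mixedPartial γ g x| ≤ Kg * sepWeight (Finset.univ.image γ) ∅) →
      ∀ n, 1 ≤ n → n ≤ 6 → ∀ (γ : Fin n → Fin N) x s,
        |mixedPartial γ (fun y => g fun i => Φ y i s) x| ≤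
          C * Real.exp (-(lam / 2) * (s - a)) * sepWeight (Finset.univ.image γ) ∅)
    {N : ℕ} {g : (Fin N → ℝ) → ℝ} (hg : TestFunctionAssumptions g Kg)
    {Ω : Type*} [mΩ : MeasurableSpace Ω] {P : Measure Ω} [IsProbabilityMeasure P]
    {ℱ : Filtration ℝ≥0 mΩ} {W : ℝ≥0 → Ω → Fin N → ℝ} (hW : IsBrownianMotion P ℱ W)
    {X : ℝ≥0 → (Fin N → ℝ) → ℝ≥0 → Ω → Fin N → ℝ}
    (hX : ∀ t x, IsParticleSolution P ℱ U V σ W t x (X t x)) {t T : ℝ≥0} (htT : t ≤ T) :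
    ContDiff ℝ 6 (kolmogorovSolution P g X T t) ∧
      ∀ n, 1 ≤ n → n ≤ 6 → ∀ (γ : Fin n → Fin N) x,
        |mixedPartial γ (kolmogorovSolution P g X T t) x| ≤
          C * Real.exp (-(lam / 2) * ((T : ℝ) - t)) * ((N : ℝ)⁻¹) ^ numDistinct γ := by
  have hab : (t : ℝ) ≤ T := NNReal.coe_le_coe.2 htT
  obtain ⟨LU, hLU⟩ := hUV.lipschitz_U
  obtain ⟨LV, hLV⟩ := hUV.lipschitz_V
  rw [← hU] at hLU
  rw [← hV] at hLV
  obtain ⟨Lg, hLg⟩ := hg.exists_lipschitzWith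
  obtain ⟨S, hS, hSiff⟩ := exists_solution_operator hab (n := 6) (by norm_num)
    (driftOp fU fV (N := N)) (contDiff_driftOp hF.contDiff_fU hF.contDiff_fV N)
    (abs_driftOp_sub_le hLU hLV)
  set e : Set.Icc (t : ℝ) (T : ℝ) := ⟨T, Set.right_mem_Icc.2 hab⟩ with he
  let ψ : Ω → (Fin N → ℝ) → Fin N → C(Set.Icc (t : ℝ) (T : ℝ), ℝ) := fun ω x i =>
    noisePath W σ t T ω i + ContinuousMap.const _ (x i)
  -- Since `noisePath` is continuous for every `ω`, the flow is smooth and its bounds hold for all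
  -- `ω`, as the differentiation lemmas require.
  let Φ : Ω → (Fin N → ℝ) → Fin N → C(Set.Icc (t : ℝ) (T : ℝ), ℝ) := fun ω x => S (ψ ω x)
  have hψ : ∀ ω, ContDiff ℝ 6 (ψ ω) := by
    intro ω
    refine contDiff_pi.2 fun i => contDiff_const.add ?_
    have h1 : (fun x : Fin N → ℝ => ContinuousMap.const (Set.Icc (t : ℝ) (T : ℝ)) (x i)) =
        fun x => (x i) • (1 : C(Set.Icc (t : ℝ) (T : ℝ), ℝ)) := by
      funext x; ext s; simp
    rw [h1]
    exact (contDiff_apply ℝ ℝ i).smul contDiff_const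
  have hΦ : ∀ ω, ContDiff ℝ 6 (Φ ω) := fun ω => hS.comp (hψ ω)
  have hΦeq : ∀ ω x i, Φ ω x i = noisePath W σ t T ω i + ContinuousMap.const _ (x i) +
      volterra hab (driftOp fU fV (Φ ω x) i) := fun ω x => (hSiff (ψ ω x) (Φ ω x)).2 rfl
  -- Uniqueness for the Volterra equation. The null set may depend on `x`, which is harmless:
  -- `u(t,x)` is an integral at one fixed `x`.
  have hident : ∀ x, ∀ᵐ ω ∂P, X t x T ω = fun i => Φ ω x i e := by
    intro x
    filter_upwards [(hX t x).ae_eq_integral_equation htT hW hU hV] with ω hω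
    obtain ⟨Z, hZ, hZX⟩ := hω
    have : Z = Φ ω x := (hSiff (ψ ω x) Z).1 hZ
    funext i
    rw [← this, hZX, Real.toNNReal_coe]
  let G : Ω → (Fin N → ℝ) → ℝ := fun ω x => g fun i => Φ ω x i e
  have hu : kolmogorovSolution P g X T t = fun x => ∫ ω, G ω x ∂P := by
    funext x
    refine integral_congr_ae ?_
    filter_upwards [hident x] with ω hω
    simp only [G, hω]
  have hGc : ∀ ω, ContDiff ℝ 6 (G ω) := fun ω =>
    hg.contDiff.comp (contDiff_pi.2 fun i => contDiff_path_apply (n := 6) (hΦ ω) i e)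
  have hGb : ∀ n, 1 ≤ n → n ≤ 6 → ∀ (γ : Fin n → Fin N) ω x, |mixedPartial γ (G ω) x| ≤
      C * Real.exp (-(lam / 2) * ((T : ℝ) - t)) * ((N : ℝ)⁻¹) ^ numDistinct γ := by
    intro n hn hn6 γ ω x
    rw [← sepWeight_empty_right]
    refine hC N t T hab _ (Φ ω) (hΦ ω) (hΦeq ω) g hg.contDiff (fun m hm hm6 δ y => ?_)
      n hn hn6 γ x e
    rw [sepWeight_empty_right, inv_pow, ← div_eq_mul_inv]
    exact hg.bound m hm hm6 δ y
  have hGi : ∀ x, Integrable (fun ω => G ω x) P := by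
    intro x
    set d : ℝ := |fU 0| + |fV 0| with hd
    set c : ℝ := ‖x‖ + d * ((T : ℝ) - t) with hc
    have hc0 : 0 ≤ c := add_nonneg (norm_nonneg _) (mul_nonneg (by positivity) (sub_nonneg.2 hab))
    obtain ⟨hi1, hi2⟩ := hW.integrable_running_noise c σ htT
    set l : ℝ := LU + 2 * LV with hl
    have hdom : Integrable (fun ω => |g 0| + Lg * ((c + |σ| * ∑ i, |W T ω i - W t ω i|) +
        l * (Real.exp (l * ((T : ℝ) - t)) * ∫ s in (t : ℝ)..(T : ℝ),
          (c + |σ| * ∑ i, |W s.toNNReal ω i - W t ω i|)))) P :=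
      (integrable_const _).add (((hi1 T).add ((hi2.const_mul _).const_mul _)).const_mul _)
    refine hdom.mono' ?_ ?_
    · have h1 : Measurable (X t x T) := ((hX t x).adapted T htT).mono (ℱ.le T) le_rfl
      refine (hg.contDiff.continuous.measurable.comp h1).aestronglyMeasurable.congr ?_
      filter_upwards [hident x] with ω hω
      simp only [G, Function.comp_apply, hω]
    · filter_upwards [hW.ae_continuous] with ω hω
      have h1 := norm_solution_le hab hLU hLV (p := ψ ω x) (Y := Φ ω x) (hΦeq ω x)
        (f := fun s => c + |σ| * ∑ i, |W s.toNNReal ω i - W t ω i|) ?_ (fun s => by positivity) ?_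
      · simp only [Real.toNNReal_coe] at h1
        have h2 := hLg.dist_le_mul (fun i => Φ ω x i e) 0
        rw [Real.dist_eq, dist_zero_right] at h2
        have h3 := abs_sub_abs_le_abs_sub (g fun i => Φ ω x i e) (g 0)
        have h4 := mul_le_mul_of_nonneg_left h1 Lg.2
        have h5 : ‖G ω x‖ = |g fun i => Φ ω x i e| := rfl
        have h6 : ‖G ω x‖ ≤ |g 0| + Lg * ‖fun i => Φ ω x i e‖ := by rw [h5]; linarith
        exact h6.trans (add_le_add le_rfl h4)
      · have : ∀ i, Continuous fun s : ℝ => W s.toNNReal ω i := fun i =>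
          (hω i).comp continuous_real_toNNReal
        fun_prop
      · intro i s
        have h2 : ψ ω x i s = σ * (W (s : ℝ).toNNReal ω i - W t ω i) + x i := by
          simp [ψ, noisePath_apply (hω i)]
        have h3 : |W (s : ℝ).toNNReal ω i - W t ω i| ≤
            ∑ i, |W (s : ℝ).toNNReal ω i - W t ω i| :=
          Finset.single_le_sum (f := fun i => |W (s : ℝ).toNNReal ω i - W t ω i|)
            (fun _ _ => abs_nonneg _) (Finset.mem_univ i)
        have h4 := mul_le_mul_of_nonneg_left h3 (abs_nonneg σ)
        have h5 : |x i| ≤ ‖x‖ := norm_le_pi_norm x i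
        have h6 := abs_add_le (σ * (W (s : ℝ).toNNReal ω i - W t ω i)) (x i)
        rw [abs_mul] at h6
        rw [h2]
        linarith
  have hnorm : ∀ k, 1 ≤ k → k ≤ 5 + 1 → ∀ ω x, ‖iteratedFDeriv ℝ k (G ω) x‖ ≤
      ∑ γ : Fin k → Fin N,
        C * Real.exp (-(lam / 2) * ((T : ℝ) - t)) * ((N : ℝ)⁻¹) ^ numDistinct γ :=
    fun k hk hk6 ω x => (norm_iteratedFDeriv_le_sum_mixedPartial k (G ω) x).trans
      (Finset.sum_le_sum fun γ _ => hGb k hk hk6 γ ω x)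
  obtain ⟨hcd, hder⟩ := contDiff_integral_of_bounded_derivatives (P := P) 5 (H := G) hGc hGi _ hnorm
  rw [hu]
  refine ⟨hcd, fun n hn hn6 γ x => ?_⟩
  unfold mixedPartial
  rw [hder n hn hn6, ← Real.norm_eq_abs]
  refine (norm_integral_le_of_norm_le_const
    (Filter.Eventually.of_forall fun ω => hGb n hn hn6 γ ω x)).trans ?_
  simp

lemma integrable_pow_and_integral_pow_le_of_bounded {Ω : Type*} [MeasurableSpace Ω]
    {P : Measure Ω} [IsProbabilityMeasure P] {f : Ω → ℝ} (hf : Measurable f) {D : ℝ}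
    (hD : ∀ ω, |f ω| ≤ D) (m : ℕ) :
    Integrable (fun ω => |f ω| ^ m) P ∧ ∫ ω, |f ω| ^ m ∂P ≤ D ^ m := by
  have hb : ∀ ω, ‖|f ω| ^ m‖ ≤ D ^ m := fun ω => by
    rw [Real.norm_of_nonneg (by positivity)]
    exact pow_le_pow_left₀ (abs_nonneg _) (hD ω) m
  have hm : Measurable fun ω => |f ω| ^ m := by fun_prop
  refine ⟨Integrable.of_bound hm.aestronglyMeasurable _ (Filter.Eventually.of_forall hb), ?_⟩
  refine (le_abs_self _).trans ?_
  simpa using norm_integral_le_of_norm_le_const (μ := P) (Filter.Eventually.of_forall hb)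

theorem lemma5p3 (U V : ℝ → ℝ) (lam KV σ Kg : ℝ) (hUV : PotentialAssumptions U V lam KV) :
    ∃ lam0 K : ℝ, 0 < lam0 ∧ lam0 < lam ∧ 0 < K ∧
      ∀ (N : ℕ) (g : (Fin N → ℝ) → ℝ), TestFunctionAssumptions g Kg →
      ∀ (Ω : Type*) (mΩ : MeasurableSpace Ω) (P : Measure Ω) (_ : IsProbabilityMeasure P)
        (ℱ : Filtration ℝ≥0 mΩ) (W : ℝ≥0 → Ω → Fin N → ℝ), IsBrownianMotion P ℱ W →
      ∀ X : ℝ≥0 → (Fin N → ℝ) → ℝ≥0 → Ω → Fin N → ℝ,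
        (∀ t x, IsParticleSolution P ℱ U V σ W t x (X t x)) →
      ∀ t T : ℝ≥0, t ≤ T →
        ContDiff ℝ 6 (kolmogorovSolution P g X T t) ∧
        ∀ ξ : Fin N → Ω → ℝ, (∀ i, Measurable[ℱ t] (ξ i)) → (∀ i, MemLp (ξ i) 2 P) →
          (∀ i j, IdentDistrib (ξ i) (ξ j) P P) →
        ∀ n : ℕ, 1 ≤ n → n ≤ 6 → ∀ γ : Fin n → Fin N,
          (Integrable
              (fun ω => |mixedPartial γ (kolmogorovSolution P g X T t) (fun i => ξ i ω)| ^ 2) P ∧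
            ∫ ω, |mixedPartial γ (kolmogorovSolution P g X T t) (fun i => ξ i ω)| ^ 2 ∂P
              ≤ K * Real.exp (-lam0 * ((T : ℝ) - t)) / (N : ℝ) ^ (2 * numDistinct γ)) ∧
          (Integrable
              (fun ω => |mixedPartial γ (kolmogorovSolution P g X T t) (fun i => ξ i ω)| ^ 4) P ∧
            ∫ ω, |mixedPartial γ (kolmogorovSolution P g X T t) (fun i => ξ i ω)| ^ 4 ∂P
              ≤ K * Real.exp (-lam0 * ((T : ℝ) - t)) / (N : ℝ) ^ (4 * numDistinct γ)) := by
  let fU : C(ℝ, ℝ) := ⟨deriv U, hUV.contDiff_U.continuous_deriv (by norm_num)⟩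
  let fV : C(ℝ, ℝ) := ⟨deriv V, hUV.contDiff_V.continuous_deriv (by norm_num)⟩
  obtain ⟨H, hF⟩ := hUV.exists_forceBounds (fU := fU) (fV := fV) rfl rfl
  obtain ⟨C, hC0, hC⟩ := exists_abs_mixedPartial_comp_flow_le hF Kg
  have hlam := hUV.lam_pos
  -- The rate is that of the pointwise bound; its second and fourth powers decay faster, and this
  -- surplus is discarded through `θ ^ m ≤ θ`. The summand `1` keeps the constant positive.
  refine ⟨lam / 2, C ^ 2 + C ^ 4 + 1, by positivity, by linarith, by positivity, ?_⟩
  intro N g hg Ω mΩ P _ ℱ W hW X hX t T htT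
  obtain ⟨hcd, hbd⟩ :=
    contDiff_kolmogorovSolution_and_abs_mixedPartial_le hUV rfl rfl hF hC hg hW hX htT
  refine ⟨hcd, fun ξ hξ _ _ n hn hn6 γ => ?_⟩
  have hmeas : Measurable fun ω =>
      mixedPartial γ (kolmogorovSolution P g X T t) (fun i => ξ i ω) := by
    have h1 : Continuous (mixedPartial γ (kolmogorovSolution P g X T t)) := by
      have := hcd.continuous_iteratedFDeriv (m := n) (by exact_mod_cast hn6)
      exact (ContinuousMultilinearMap.apply ℝ (fun _ : Fin n => Fin N → ℝ) ℝ
        (fun k => Pi.single (γ k) 1)).continuous.comp this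
    exact h1.measurable.comp
      (measurable_pi_lambda _ fun i => (hξ i).mono (ℱ.le t) le_rfl)
  set θ := Real.exp (-(lam / 2) * ((T : ℝ) - t)) with hθ
  have hθ0 : 0 ≤ θ := (Real.exp_pos _).le
  have hθ1 : θ ≤ 1 := Real.exp_le_one_iff.2 (mul_nonpos_of_nonpos_of_nonneg (by linarith)
    (sub_nonneg.2 (NNReal.coe_le_coe.2 htT)))
  have hfin : ∀ m : ℕ, m ≠ 0 → C ^ m ≤ C ^ 2 + C ^ 4 + 1 →
      (C * θ * ((N : ℝ)⁻¹) ^ numDistinct γ) ^ m ≤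
        (C ^ 2 + C ^ 4 + 1) * θ / (N : ℝ) ^ (m * numDistinct γ) := by
    intro m hm hCm
    rw [mul_pow, mul_pow, ← pow_mul, inv_pow, ← div_eq_mul_inv, mul_comm (numDistinct γ) m]
    have : θ ^ m ≤ θ := pow_le_of_le_one hθ0 hθ1 hm
    gcongr
  have h2 := integrable_pow_and_integral_pow_le_of_bounded (P := P) hmeas
    (fun ω => hbd n hn hn6 γ fun i => ξ i ω) 2
  have h4 := integrable_pow_and_integral_pow_le_of_bounded (P := P) hmeas
    (fun ω => hbd n hn hn6 γ fun i => ξ i ω) 4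
  have hC2 : 0 ≤ C ^ 2 := by positivity
  have hC4 : 0 ≤ C ^ 4 := by positivity
  exact ⟨⟨h2.1, h2.2.trans (hfin 2 (by norm_num) (by linarith))⟩,
    ⟨h4.1, h4.2.trans (hfin 4 (by norm_num) (by linarith))⟩⟩
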